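/- **Theorem 4.** Let $m,n\ge 1$, let $f_{(1)},\dots,f_{(m)}:\mathbb R^n\to\mathbb R$ be differentiable, $\mu$-strongly convex with $\mu>0$ (that is, $f_{(i)}(y)\ge f_{(i)}(x)+\langle\nabla f_{(i)}(x),y-x\rangle+\frac\mu2\|y-x\|^2$ for all $x,y$) and $L$-smooth (that is, $\|\nabla f_{(i)}(y)-\nabla f_{(i)}(x)\|\le L\|y-x\|$ for all $x,y$). Put $F=\frac1m\sum_{i=1}^m f_{(i)}$ and let $x^*$ be the minimizer of $F$. Aggregate variables are matrices $\mathbf x\in\mathbb R^{m\times n}$ with rows $x_{(1)}^T,\dots,x_{(m)}^T$ and Frobenius norm $\|\cdot\|$; $\nabla f(\mathbf x)$ has rows $\nabla f_{(i)}(x_{(i)})^T$, $\overline x=\frac1m\sum_i x_{(i)}$ is the average of the rows, and $\Pi=I-\frac1m\mathbf 1\mathbf 1^T$. Let $(\mathcal G^k)_{k\ge0}$ be graphs on $\{1,\dots,m\}$ with edge sets $\mathcal E^k$, and let $\gamma\ge1$ be an integer. Let $(W_1^k)_k,(W_2^k)_k,(W_3^k)_k$ be three sequences of real $m\times m$ matrices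 such that, for each $j\in\{1,2,3\}$ and all $k\geq 0$, the entry $(W_j^k)_{il}$ is positive if $(i,l)\in\mathcal E^k$ or $i=l$ and is zero otherwise; $W_j^k\mathbf 1=\mathbf 1$ and $\mathbf 1^TW_j^k=\mathbf 1^T$; and (the $\gamma$-step joint spectrum property) $$\sigma_\gamma:=\max_{j=1,2,3}\ \sup_{k\ge\gamma-1}\Big\|W_j^kW_j^{k-1}\cdots W_j^{k-\gamma+1}-\tfrac1m\mathbf 1\mathbf 1^T\Big\|_2<1 ,$$ where $\|\cdot\|_2$ is the spectral norm. Let $\alpha>0$ and $\theta=\frac{\sqrt{\mu\alpha}}2$. Accelerated gradient tracking starts from $\mathbf x^0=\mathbf y^0=\mathbf z^0$ with $\Pi\mathbf x^0=0$ and $\mathbf s^0=\nabla f(\mathbf y^0)$, and computes $$\mathbf y^k=\theta\mathbf z^k+(1-\theta)\mathbf x^k,\qquad \mathbf s^k=W_1^k\mathbf s^{k-1}+\nabla f(\mathbf y^k)-\nabla f(\mathbf y^{k-1})\quad(k\geq 1),$$ $$\mathbf z^{k+1}=\frac1{1+\frac{\mu\alpha}\theta}\Big(W_2^k\big(\tfrac{\mu\alpha}\theta\mathbf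 y^k+\mathbf z^k\big)-\tfrac\alpha\theta\mathbf s^k\Big),\qquad \mathbf x^{k+1}=\theta\mathbf z^{k+1}+(1-\theta)W_3^k\mathbf x^k\quad(k\geq 0).$$ Put $$C=F(\overline x^0)-F(x^*)+\Big(\frac{\theta^2}{2\alpha}+\frac{\mu\theta}2\Big)\|\overline z^0-x^*\|^2+\frac{1-\sigma_\gamma}{49mL\gamma(1-\theta)}\max_{1\le r\le\gamma}\|\Pi\mathbf s^r\|^2+\frac{1459L\gamma^3}{m(1-\theta)(1-\sigma_\gamma)^3}\max_{1\le r\le\gamma}\theta^2\|\Pi\mathbf z^r\|^2+\frac{6.6L\gamma}{m(1-\theta)(1-\sigma_\gamma)}\max_{1\le r\le\gamma}\|\Pi\mathbf x^r\|^2 .$$ (i) If $\alpha\le\frac{(1-\sigma_\gamma)^3}{4244L\gamma^3}$, then for every integer $T\ge0$ $$F(\overline x^{T\gamma+1})-F(x^*)+\Big(\frac{\theta^2}{2\alpha}+\frac{\mu\theta}2\Big)\|\overline z^{T\gamma+1}-x^*\|^2\le(1-\theta)^{T\gamma+1}C,\qquad \frac1m\|\Pi\mathbf x^{T\gamma}\|^2\le(1-\theta)^{T\gamma+1}\frac{4C}L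 .$$ (ii) (Complexity.) Let $R=\big(\frac\gamma{1-\sigma_\gamma}\big)^{1.5}\sqrt{\frac L\mu}$. There is an absolute constant $c>0$ (independent of all the data above) such that, for $\alpha=\frac{(1-\sigma_\gamma)^3}{4244L\gamma^3}$ and every $\varepsilon>0$: whenever $C=0$ or $T\gamma+1\ge c\,R\log\frac C\varepsilon$, one has $F(\overline x^{T\gamma+1})-F(x^*)\le\varepsilon$ and $\frac1m\|\Pi\mathbf x^{T\gamma}\|^2\le\frac{4\varepsilon}L$; and if moreover $\varepsilon\le\frac12$ and $C\varepsilon\le1$, then for some $T\ge0$ one has $F(\overline x^{T\gamma+1})-F(x^*)\le\varepsilon$, while computing the first $T\gamma+1$ iterations takes at most $c\,R\log\frac1\varepsilon$ gradient evaluations per agent and at most $c\,R\log\frac1\varepsilon$ rounds of communication (one round for each multiplication by a weight matrix). In other words, $O\big((\frac\gamma{1-\sigma_\gamma})^{1.5}\sqrt{\frac L\mu}\log\frac1\varepsilon\big)$ gradient evaluations and communication rounds suffice. -/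

import Mathlib

open scoped BigOperators InnerProductSpace

noncomputable section

namespace AccGT

/-! ### Aggregate variables -/

/-- The local decision space `ℝⁿ` with its Euclidean norm. -/
abbrev Vec (n : ℕ) : Type := EuclideanSpace ℝ (Fin n)

/-- An aggregate variable, that is, an `m × n` matrix given by its `m` rows
(row `i` is the local variable of agent `i`). -/
abbrev Agg (m n : ℕ) : Type := Fin m → Vec n

/-- The average of the rows. -/
def average {m n : ℕ} (v : Agg m n) : Vec n := (1 / (m : ℝ)) • ∑ i, v i

/-- `Π v = (I - (1/m) 1 1ᵀ) v`: row `i` is `v i` minus the average of the rows. -/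
def consensusError {m n : ℕ} (v : Agg m n) : Agg m n := fun i => v i - average v

/-- The squared Frobenius norm of an aggregate variable. -/
def frobSq {m n : ℕ} (v : Agg m n) : ℝ := ∑ i, ‖v i‖ ^ 2

/-- The product `W v` of an `m × m` matrix with an aggregate variable. -/
def mix {m n : ℕ} (W : Matrix (Fin m) (Fin m) ℝ) (v : Agg m n) : Agg m n :=
  fun i => ∑ j, W i j • v j

/-- The aggregate gradient: row `i` is the gradient of the `i`-th local function at row `i`. -/
def aggGradient {m n : ℕ} (f : Fin m → Vec n → ℝ) (v : Agg m n) : Agg m n :=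
  fun i => gradient (f i) (v i)

/-! ### Assumptions on the local functions -/

/-- `μ`-strong convexity, in first-order form. -/
def StronglyConvex {n : ℕ} (μ : ℝ) (g : Vec n → ℝ) : Prop :=
  ∀ x y : Vec n, g x + ⟪gradient g x, y - x⟫_ℝ + μ / 2 * ‖y - x‖ ^ 2 ≤ g y

/-- `L`-smoothness: differentiable with `L`-Lipschitz gradient. -/
def Smooth {n : ℕ} (L : ℝ) (g : Vec n → ℝ) : Prop :=
  Differentiable ℝ g ∧ ∀ x y : Vec n, ‖gradient g y - gradient g x‖ ≤ L * ‖y - x‖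

/-! ### Weight matrices over a time-varying graph -/

/-- The matrix `(1/m) 1 1ᵀ`. -/
def averagingMatrix (m : ℕ) : Matrix (Fin m) (Fin m) ℝ := Matrix.of fun _ _ => 1 / (m : ℝ)

/-- The product of `t` consecutive weight matrices `W k * W (k-1) * ⋯ * W (k-t+1)`,
used for `t ≤ k + 1` only; it is the identity for `t = 0`. -/
def windowProd {m : ℕ} (W : ℕ → Matrix (Fin m) (Fin m) ℝ) (k t : ℕ) :
    Matrix (Fin m) (Fin m) ℝ :=
  ((List.range t).map fun j => W (k - j)).prod

/-- The spectral norm of a matrix. -/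
def spectralNorm {m : ℕ} (A : Matrix (Fin m) (Fin m) ℝ) : ℝ :=
  ‖Matrix.toEuclideanCLM (𝕜 := ℝ) A‖

/-- The supremum over all `k ≥ γ - 1` of the spectral norm of
`W k * ⋯ * W (k-γ+1) - (1/m) 1 1ᵀ`. The family is bounded for doubly stochastic nonnegative
matrices. -/
def jointSigma {m : ℕ} (W : ℕ → Matrix (Fin m) (Fin m) ℝ) (γ : ℕ) : ℝ :=
  ⨆ k : {k : ℕ // γ ≤ k + 1}, spectralNorm (windowProd W k.1 γ - averagingMatrix m)

/-- The standing assumptions on a sequence of weight matrices associated with the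
time-varying graph `G`. -/
structure IsWeightSequence {m : ℕ} (G : ℕ → Digraph (Fin m))
    (W : ℕ → Matrix (Fin m) (Fin m) ℝ) (γ : ℕ) : Prop where
  /-- Entries are positive on the edges and on the diagonal, -/
  pos : ∀ k i j, (G k).Adj i j ∨ i = j → 0 < W k i j
  /-- and zero elsewhere. -/
  zero : ∀ k i j, ¬((G k).Adj i j ∨ i = j) → W k i j = 0
  /-- Rows sum to one. -/
  row_sum : ∀ k i, ∑ j, W k i j = 1
  /-- Columns sum to one. -/
  col_sum : ∀ k j, ∑ i, W k i j = 1
  /-- The `γ`-step joint spectrum property. -/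
  joint_spectrum : jointSigma W γ < 1

/-! ### Computations with a count of gradient evaluations and communication rounds -/

/-- A value together with the resources spent on it: `grads` counts evaluations of the aggregate
gradient (one local gradient per agent), `comms` counts rounds of communication. -/
structure Counted (β : Type) where
  val : β
  grads : ℕ
  comms : ℕ

instance : Monad Counted where
  pure b := ⟨b, 0, 0⟩
  bind c g := ⟨(g c.val).val, c.grads + (g c.val).grads, c.comms + (g c.val).comms⟩

/-- One round of communication: every agent receives a weighted sum of its neighbours' rows. -/
def communicate {m n : ℕ} (W : Matrix (Fin m) (Fin m) ℝ) (v : Agg m n) : Counted (Agg m n) :=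
  ⟨mix W v, 0, 1⟩

/-- One gradient evaluation by every agent. -/
def evalGradient {m n : ℕ} (f : Fin m → Vec n → ℝ) (v : Agg m n) : Counted (Agg m n) :=
  ⟨aggGradient f v, 1, 0⟩

/-! ### Accelerated gradient tracking -/

/-- The data of a problem and of a run of the algorithm on it. -/
structure Setting (m n : ℕ) where
  /-- local objective functions -/
  f : Fin m → Vec n → ℝ
  /-- the time-varying graph -/
  G : ℕ → Digraph (Fin m)
  /-- the three sequences of weight matrices -/
  W₁ : ℕ → Matrix (Fin m) (Fin m) ℝ
  W₂ : ℕ → Matrix (Fin m) (Fin m) ℝ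
  W₃ : ℕ → Matrix (Fin m) (Fin m) ℝ
  /-- the window length, a positive integer -/
  γ : ℕ
  one_le_γ : 1 ≤ γ
  /-- strong convexity constant, smoothness constant, step size -/
  μ : ℝ
  L : ℝ
  α : ℝ
  /-- initial point -/
  x₀ : Agg m n
  /-- a point of `ℝⁿ`, to be the optimal solution -/
  xstar : Vec n

/-- The iterates `x^k, y^k, z^k, s^k` and the stored gradient `g = ∇f(y^k)`. -/
structure State (m n : ℕ) where
  x : Agg m n
  y : Agg m n
  z : Agg m n
  s : Agg m n
  g : Agg m n

namespace Setting

variable {m n : ℕ} (P : Setting m n)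

/-- The objective `F = (1/m) ∑ f_i`. -/
def F (x : Vec n) : ℝ := (1 / (m : ℝ)) * ∑ i, P.f i x

/-- The parameter `θ = √(μ α) / 2`. -/
def θ : ℝ := Real.sqrt (P.μ * P.α) / 2

/-- The joint contraction constant `σ_γ` common to the three weight sequences. -/
def σ : ℝ := max (jointSigma P.W₁ P.γ) (max (jointSigma P.W₂ P.γ) (jointSigma P.W₃ P.γ))

/-- The standing assumptions, with `μ > 0`; `xstar` minimizes `F`, and the initial point is in
consensus. -/
structure Assumptions : Prop where
  m_pos : 0 < m
  n_pos : 0 < n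
  μ_pos : 0 < P.μ
  stronglyConvex : ∀ i, StronglyConvex P.μ (P.f i)
  smooth : ∀ i, Smooth P.L (P.f i)
  weights₁ : IsWeightSequence P.G P.W₁ P.γ
  weights₂ : IsWeightSequence P.G P.W₂ P.γ
  weights₃ : IsWeightSequence P.G P.W₃ P.γ
  optimal : ∀ x, P.F P.xstar ≤ P.F x
  consensus : consensusError P.x₀ = 0

/-- Initialization: `x⁰ = y⁰ = z⁰` and `s⁰ = ∇f(y⁰)`. -/
def init : Counted (State m n) := do
  let g ← evalGradient P.f P.x₀
  return { x := P.x₀, y := P.x₀, z := P.x₀, s := g, g := g }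

/-- One iteration, from `x^k, y^k, z^k, s^k` to `x^(k+1), y^(k+1), z^(k+1), s^(k+1)`. -/
def step (k : ℕ) (S : State m n) : Counted (State m n) := do
  let u ← communicate (P.W₂ k) ((P.μ * P.α / P.θ) • S.y + S.z)
  let z := (1 / (1 + P.μ * P.α / P.θ)) • (u - (P.α / P.θ) • S.s)
  let v ← communicate (P.W₃ k) S.x
  let x := P.θ • z + (1 - P.θ) • v
  let y := P.θ • z + (1 - P.θ) • x
  let g ← evalGradient P.f y
  let w ← communicate (P.W₁ (k + 1)) S.s
  let s := w + g - S.g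
  return { x := x, y := y, z := z, s := s, g := g }

/-- The computation of the first `k` iterations. -/
def run : ℕ → Counted (State m n)
  | 0 => P.init
  | k + 1 => do
    let S ← run k
    P.step k S

/-- The iterates. -/
def x (k : ℕ) : Agg m n := (P.run k).val.x
def z (k : ℕ) : Agg m n := (P.run k).val.z
def s (k : ℕ) : Agg m n := (P.run k).val.s

/-- The maximum of `a 1, …, a γ`. -/
def windowMax (a : ℕ → ℝ) : ℝ :=
  (Finset.Icc 1 P.γ).sup' (Finset.nonempty_Icc.mpr P.one_le_γ) a

/-- The consensus errors over the first `γ` steps. -/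
def Ms : ℝ := P.windowMax fun r => frobSq (consensusError (P.s r))
def Mz : ℝ := P.windowMax fun r => P.θ ^ 2 * frobSq (consensusError (P.z r))
def Mx : ℝ := P.windowMax fun r => frobSq (consensusError (P.x r))

/-- The constant `C` of the rates. -/
def C : ℝ :=
  P.F (average (P.x 0)) - P.F P.xstar
    + (P.θ ^ 2 / (2 * P.α) + P.μ * P.θ / 2) * ‖average (P.z 0) - P.xstar‖ ^ 2
    + (1 - P.σ) / (49 * m * P.L * P.γ * (1 - P.θ)) * P.Ms
    + 1459 * P.L * (P.γ : ℝ) ^ 3 / (m * (1 - P.θ) * (1 - P.σ) ^ 3) * P.Mz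
    + 6.6 * P.L * P.γ / (m * (1 - P.θ) * (1 - P.σ)) * P.Mx

/-- The largest step size that is allowed. -/
def maxStep : ℝ := (1 - P.σ) ^ 3 / (4244 * P.L * (P.γ : ℝ) ^ 3)

/-- The factor `(γ / (1 - σ_γ))^1.5 √(L/μ)`. -/
def rateFactor : ℝ := ((P.γ : ℝ) / (1 - P.σ)) ^ (3 / 2 : ℝ) * Real.sqrt (P.L / P.μ)

end Setting

end AccGT

end

/-!
The averages of the rows follow Nesterov's accelerated method for `F`, run with an inexact oracle:
the average of `s^k` is the average of the local gradients at the rows of `y^k`. Its usual potential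
therefore contracts by `1 - θ` at each step, up to an error `(L / m) ‖Π y^k‖²`, and what the usual
proof throws away is kept: a multiple of the squared movement of the average of `z`, and, by
cocoercivity, a multiple of the gradient gap `∑ ‖∇f_i(x̄^k) - ∇f_i(y_i^k)‖²`
(`Setting.Admissible.potential_succ_le`).

The consensus errors of `x`, `z` and `s` each obey a perturbed averaging recursion, so over a window
of `γ` steps their squares contract by `σ` up to perturbations
(`frobSq_consensusError_window`). Summed with the weights `(1 - θ)⁻ᵏ`, which grow by less than the
spectral gap over a window, each recursion bounds its weighted sum by its first window and by
`(γ / (1 - σ))²` times the weighted sum of its perturbations (`weighted_sum_le`). The error of `x` is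
driven by that of `z`, the error of `z` by `α` times those of `s` and `y`, and the error of `s` by the
change of the gradients, which the two retained terms control. The factor `α ^ 2` picked up on the way
from `s` to `z` beats the sixth power of `γ / (1 - σ)` that the three recursions produce, so the loop
closes (`consensus_budget`). This gives `Setting.Admissible.lyapunov_le`, which contains both
rates. Since the largest step makes `θ` a constant multiple of `1 / R`, the complexity bounds follow
from `1 - θ ≤ exp (-θ)`.

The quadratic upper bound and cocoercivity are used with constants worse by a factor of two than the
optimal ones: in this form they follow from the first-order inequalities alone, and the constants of
the theorem leave room for the loss.
-/

open scoped BigOperators InnerProductSpace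

noncomputable section

namespace AccGT

/-! ### Frobenius norm and mixing of aggregate variables -/

/-- The Frobenius norm of an aggregate variable, as the norm of the `ℓ²` product of its rows. -/
def frob {m n : ℕ} (v : Agg m n) : ℝ := ‖WithLp.toLp 2 v‖

section Aggregate

variable {m n : ℕ}

lemma frob_sq (v : Agg m n) : frob v ^ 2 = frobSq v := by
  simp [frob, frobSq, PiLp.norm_sq_eq_of_L2]

lemma frob_nonneg (v : Agg m n) : 0 ≤ frob v := norm_nonneg _

lemma frobSq_nonneg (v : Agg m n) : 0 ≤ frobSq v :=
  Finset.sum_nonneg fun _ _ => sq_nonneg _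

lemma frob_add_le (u v : Agg m n) : frob (u + v) ≤ frob u + frob v := by
  unfold frob; rw [WithLp.toLp_add]; exact norm_add_le _ _

lemma frob_smul (c : ℝ) (v : Agg m n) : frob (c • v) = |c| * frob v := by
  unfold frob; rw [WithLp.toLp_smul, norm_smul, Real.norm_eq_abs]

lemma frobSq_smul (c : ℝ) (v : Agg m n) : frobSq (c • v) = c ^ 2 * frobSq v := by
  rw [← frob_sq, frob_smul, mul_pow, sq_abs, frob_sq]

lemma frobSq_add_le (u v : Agg m n) :
    frobSq (u + v) ≤ 2 * frobSq u + 2 * frobSq v := by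
  rw [← frob_sq, ← frob_sq, ← frob_sq]
  have h := frob_add_le u v
  nlinarith [sq_nonneg (frob u - frob v), frob_nonneg u, frob_nonneg v, frob_nonneg (u + v)]

lemma frob_le_of_frobSq_le {v : Agg m n} {b : ℝ} (hb : 0 ≤ b) (h : frobSq v ≤ b ^ 2) :
    frob v ≤ b :=
  abs_le_of_sq_le_sq' (by rwa [frob_sq]) hb |>.2

lemma average_add (u v : Agg m n) : average (u + v) = average u + average v := by
  simp [average, Finset.sum_add_distrib]

lemma average_sub (u v : Agg m n) : average (u - v) = average u - average v := by
  simp [average, Finset.sum_sub_distrib, smul_sub]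

lemma average_smul (c : ℝ) (v : Agg m n) : average (c • v) = c • average v := by
  simp only [average, Pi.smul_apply, ← Finset.smul_sum]
  rw [smul_comm]

lemma smul_average (hm : 0 < m) (v : Agg m n) : (m : ℝ) • average v = ∑ i, v i := by
  have : (m : ℝ) ≠ 0 := by positivity
  simp [average, smul_smul, this]

lemma sum_consensusError (hm : 0 < m) (v : Agg m n) : ∑ i, consensusError v i = 0 := by
  simp only [consensusError, Finset.sum_sub_distrib, Finset.sum_const, Finset.card_univ,
    Fintype.card_fin]
  rw [← smul_average hm, Nat.cast_smul_eq_nsmul, sub_self]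

lemma consensusError_add (u v : Agg m n) :
    consensusError (u + v) = consensusError u + consensusError v := by
  funext i; simp only [consensusError, average_add, Pi.add_apply]; abel

lemma consensusError_sub (u v : Agg m n) :
    consensusError (u - v) = consensusError u - consensusError v := by
  funext i; simp only [consensusError, average_sub, Pi.sub_apply]; abel

lemma consensusError_smul (c : ℝ) (v : Agg m n) :
    consensusError (c • v) = c • consensusError v := by
  funext i; simp only [consensusError, average_smul, Pi.smul_apply, smul_sub]

/-- Bias-variance decomposition of the squared distances from a point to the rows. -/
lemma sum_norm_sub_sq (hm : 0 < m) (v : Agg m n) (w : Vec n) :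
    ∑ i, ‖w - v i‖ ^ 2 = m * ‖w - average v‖ ^ 2 + frobSq (consensusError v) := by
  have h : ∀ i, ‖w - v i‖ ^ 2 = ‖w - average v‖ ^ 2
      - 2 * ⟪w - average v, consensusError v i⟫_ℝ + ‖consensusError v i‖ ^ 2 := by
    intro i
    rw [← norm_sub_sq_real]
    simp [consensusError]
  simp only [h, Finset.sum_add_distrib, Finset.sum_sub_distrib, ← Finset.mul_sum, ← inner_sum,
    sum_consensusError hm, frobSq]
  simp

lemma frobSq_consensusError_le (hm : 0 < m) (v : Agg m n) :
    frobSq (consensusError v) ≤ frobSq v := by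
  have := sum_norm_sub_sq hm v 0
  simp only [zero_sub, norm_neg] at this
  have h2 : (0 : ℝ) ≤ m * ‖average v‖ ^ 2 := by positivity
  unfold frobSq at *
  linarith

lemma mix_add (W : Matrix (Fin m) (Fin m) ℝ) (u v : Agg m n) :
    mix W (u + v) = mix W u + mix W v := by
  funext i; simp [mix, Finset.sum_add_distrib]

lemma mix_sub (W : Matrix (Fin m) (Fin m) ℝ) (u v : Agg m n) :
    mix W (u - v) = mix W u - mix W v := by
  funext i; simp [mix, smul_sub, Finset.sum_sub_distrib]

lemma mix_smul (W : Matrix (Fin m) (Fin m) ℝ) (c : ℝ) (v : Agg m n) :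
    mix W (c • v) = c • mix W v := by
  funext i; simp only [mix, Pi.smul_apply, Finset.smul_sum, smul_comm c]

lemma mix_mul (A B : Matrix (Fin m) (Fin m) ℝ) (v : Agg m n) :
    mix (A * B) v = mix A (mix B v) := by
  funext i
  simp only [mix, Matrix.mul_apply, Finset.smul_sum, Finset.sum_smul, smul_smul]
  exact Finset.sum_comm

lemma sub_mix (A B : Matrix (Fin m) (Fin m) ℝ) (v : Agg m n) :
    mix (A - B) v = mix A v - mix B v := by
  funext i; simp [mix, sub_smul, Finset.sum_sub_distrib]

lemma mix_averagingMatrix (v : Agg m n) : mix (averagingMatrix m) v = fun _ => average v := by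
  funext i; simp [mix, averagingMatrix, average, Finset.smul_sum]

/-- A matrix acts on each column of an aggregate variable, so its spectral norm bounds its action
in the Frobenius norm. -/
lemma frobSq_mix_le (A : Matrix (Fin m) (Fin m) ℝ) (v : Agg m n) :
    frobSq (mix A v) ≤ spectralNorm A ^ 2 * frobSq v := by
  have key : ∀ u : Agg m n,
      frobSq u = ∑ c, ‖(WithLp.toLp 2 (fun i => u i c) : EuclideanSpace ℝ (Fin m))‖ ^ 2 := by
    intro u
    simp only [frobSq, EuclideanSpace.norm_sq_eq]
    exact Finset.sum_comm
  rw [key, key, Finset.mul_sum]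
  refine Finset.sum_le_sum fun c _ => ?_
  have h : (WithLp.toLp 2 (fun i => mix A v i c) : EuclideanSpace ℝ (Fin m))
      = Matrix.toEuclideanCLM (𝕜 := ℝ) A (WithLp.toLp 2 (fun i => v i c)) := by
    rw [Matrix.toEuclideanCLM_toLp]
    congr 1
    funext i
    simp [mix, Matrix.mulVec, dotProduct]
  rw [h, ← mul_pow]
  gcongr
  exact ContinuousLinearMap.le_opNorm _ _

end Aggregate

/-! ### Doubly stochastic matrices -/

/-- A nonnegative matrix whose rows and columns sum to one. -/
structure DoublyStochastic {m : ℕ} (W : Matrix (Fin m) (Fin m) ℝ) : Prop where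
  nonneg : ∀ i j, 0 ≤ W i j
  row_sum : ∀ i, ∑ j, W i j = 1
  col_sum : ∀ j, ∑ i, W i j = 1

namespace DoublyStochastic

variable {m n : ℕ} {W : Matrix (Fin m) (Fin m) ℝ}

/-- Convexity of the squared norm, row by row: a doubly stochastic matrix does not increase the sum
of the squared norms. -/
lemma sum_norm_sq_le {E : Type*} [NormedAddCommGroup E] [NormedSpace ℝ E]
    (hW : DoublyStochastic W) (v : Fin m → E) :
    ∑ i, ‖∑ j, W i j • v j‖ ^ 2 ≤ ∑ j, ‖v j‖ ^ 2 := by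
  have h : ∀ i, ‖∑ j, W i j • v j‖ ^ 2 ≤ ∑ j, W i j * ‖v j‖ ^ 2 := fun i => by
    have hconv : ConvexOn ℝ Set.univ fun x : E => ‖x‖ ^ 2 :=
      (convexOn_norm convex_univ).pow (fun _ _ => norm_nonneg _) 2
    simpa using hconv.map_sum_le (t := Finset.univ) (w := fun j => W i j) (p := v)
      (fun j _ => hW.nonneg i j) (hW.row_sum i) (fun _ _ => Set.mem_univ _)
  refine (Finset.sum_le_sum fun i _ => h i).trans_eq ?_
  rw [Finset.sum_comm]
  simp [← Finset.sum_mul, hW.col_sum]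

lemma frob_mix_le (hW : DoublyStochastic W) (v : Agg m n) : frob (mix W v) ≤ frob v :=
  frob_le_of_frobSq_le (frob_nonneg _) (by rw [frob_sq]; exact hW.sum_norm_sq_le v)

lemma spectralNorm_le (hW : DoublyStochastic W) : spectralNorm W ≤ 1 := by
  refine ContinuousLinearMap.opNorm_le_bound _ zero_le_one fun v => ?_
  rw [one_mul]
  refine abs_le_of_sq_le_sq' ?_ (norm_nonneg _) |>.2
  rw [EuclideanSpace.norm_sq_eq, EuclideanSpace.norm_sq_eq]
  simpa [Matrix.mulVec, dotProduct] using hW.sum_norm_sq_le fun j => v j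

lemma average_mix (hW : DoublyStochastic W) (v : Agg m n) : average (mix W v) = average v := by
  simp only [average, mix]
  rw [Finset.sum_comm]
  simp [← Finset.sum_smul, hW.col_sum]

lemma consensusError_mix (hW : DoublyStochastic W) (v : Agg m n) :
    consensusError (mix W v) = mix W (consensusError v) := by
  funext i
  simp only [consensusError, hW.average_mix, mix, smul_sub, Finset.sum_sub_distrib,
    ← Finset.sum_smul, hW.row_sum, one_smul]

lemma one : DoublyStochastic (1 : Matrix (Fin m) (Fin m) ℝ) where
  nonneg i j := by rw [Matrix.one_apply]; split_ifs <;> norm_num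
  row_sum i := by simp [Matrix.one_apply]
  col_sum i := by simp [Matrix.one_apply]

lemma mul {V : Matrix (Fin m) (Fin m) ℝ} (hV : DoublyStochastic V) (hW : DoublyStochastic W) :
    DoublyStochastic (V * W) where
  nonneg i j := by
    rw [Matrix.mul_apply]
    exact Finset.sum_nonneg fun k _ => mul_nonneg (hV.nonneg i k) (hW.nonneg k j)
  row_sum i := by
    simp only [Matrix.mul_apply]
    rw [Finset.sum_comm]
    simp [← Finset.mul_sum, hW.row_sum, hV.row_sum]
  col_sum j := by
    simp only [Matrix.mul_apply]
    rw [Finset.sum_comm]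
    simp [← Finset.sum_mul, hW.col_sum, hV.col_sum]

lemma averagingMatrix (hm : 0 < m) : DoublyStochastic (averagingMatrix m) where
  nonneg i j := by simp [AccGT.averagingMatrix]
  row_sum i := by simp [AccGT.averagingMatrix]; field_simp
  col_sum i := by simp [AccGT.averagingMatrix]; field_simp

lemma windowProd {V : ℕ → Matrix (Fin m) (Fin m) ℝ} (hV : ∀ k, DoublyStochastic (V k))
    (k t : ℕ) : DoublyStochastic (windowProd V k t) := by
  unfold AccGT.windowProd
  induction List.range t with
  | nil => exact one
  | cons j l ih => simpa using (hV (k - j)).mul ih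

end DoublyStochastic

lemma IsWeightSequence.doublyStochastic {m : ℕ} {G : ℕ → Digraph (Fin m)}
    {W : ℕ → Matrix (Fin m) (Fin m) ℝ} {γ : ℕ} (hW : IsWeightSequence G W γ) (k : ℕ) :
    DoublyStochastic (W k) where
  nonneg i j := by
    by_cases h : (G k).Adj i j ∨ i = j
    · exact (hW.pos k i j h).le
    · exact (hW.zero k i j h).ge
  row_sum := hW.row_sum k
  col_sum := hW.col_sum k

lemma windowProd_succ {m : ℕ} (W : ℕ → Matrix (Fin m) (Fin m) ℝ) (k t : ℕ) :
    windowProd W (k + 1) (t + 1) = W (k + 1) * windowProd W k t := by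
  simp [windowProd, List.range_succ_eq_map, Function.comp_def]

/-- The joint spectral constant bounds every window. The bound `2` makes the family bounded, so that
the supremum is not a junk value. -/
lemma spectralNorm_window_le {m : ℕ} (hm : 0 < m) {W : ℕ → Matrix (Fin m) (Fin m) ℝ}
    (hW : ∀ k, DoublyStochastic (W k)) {k γ : ℕ} (hk : γ ≤ k + 1) :
    spectralNorm (windowProd W k γ - averagingMatrix m) ≤ jointSigma W γ := by
  refine le_ciSup (f := fun k : {k : ℕ // γ ≤ k + 1} =>
    spectralNorm (windowProd W k.1 γ - averagingMatrix m)) ⟨2, ?_⟩ ⟨k, hk⟩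
  rintro _ ⟨l, rfl⟩
  have h1 := (DoublyStochastic.windowProd hW l.1 γ).spectralNorm_le
  have h2 := (DoublyStochastic.averagingMatrix hm).spectralNorm_le
  have h3 := norm_sub_le (Matrix.toEuclideanCLM (𝕜 := ℝ) (windowProd W l.1 γ))
    (Matrix.toEuclideanCLM (𝕜 := ℝ) (averagingMatrix m))
  rw [← map_sub] at h3
  unfold spectralNorm at *
  dsimp only
  linarith

lemma jointSigma_nonneg {m : ℕ} (W : ℕ → Matrix (Fin m) (Fin m) ℝ) (γ : ℕ) :
    0 ≤ jointSigma W γ := Real.iSup_nonneg fun _ => norm_nonneg _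

/-- A full window of weight matrices contracts the consensus error. -/
lemma frob_mix_window_le {m n : ℕ} (hm : 0 < m) {W : ℕ → Matrix (Fin m) (Fin m) ℝ}
    (hW : ∀ k, DoublyStochastic (W k)) {k γ : ℕ} (hk : γ ≤ k + 1) (v : Agg m n) :
    frob (mix (windowProd W k γ) (consensusError v))
      ≤ jointSigma W γ * frob (consensusError v) := by
  have h0 : average (consensusError v) = 0 := by
    simp [average, sum_consensusError hm]
  have h1 : mix (windowProd W k γ) (consensusError v)
      = mix (windowProd W k γ - averagingMatrix m) (consensusError v) := by
    rw [sub_mix, mix_averagingMatrix, h0]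
    funext i; simp
  rw [h1]
  refine frob_le_of_frobSq_le (mul_nonneg (jointSigma_nonneg _ _) (frob_nonneg _)) ?_
  refine (frobSq_mix_le _ _).trans ?_
  rw [mul_pow, frob_sq]
  gcongr
  · exact frobSq_nonneg _
  · exact norm_nonneg _
  · exact spectralNorm_window_le hm hW hk

lemma jointSigma_shift_le {m : ℕ} (hm : 0 < m) {W : ℕ → Matrix (Fin m) (Fin m) ℝ}
    (hW : ∀ k, DoublyStochastic (W k)) (γ : ℕ) :
    jointSigma (fun k => W (k + 1)) γ ≤ jointSigma W γ := by
  have : Nonempty {k : ℕ // γ ≤ k + 1} := ⟨⟨γ, by omega⟩⟩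
  refine ciSup_le fun k => ?_
  have h : windowProd (fun k => W (k + 1)) k.1 γ = windowProd W (k.1 + 1) γ := by
    unfold windowProd
    congr 1
    refine List.map_congr_left fun j hj => ?_
    have := List.mem_range.1 hj
    have := k.2
    change W (k.1 - j + 1) = W (k.1 + 1 - j)
    congr 1
    omega
  rw [h]
  exact spectralNorm_window_le hm hW (by have := k.2; omega)

/-! ### Consensus error of a perturbed averaging recursion -/

section Recursion

variable {m n : ℕ} {W : ℕ → Matrix (Fin m) (Fin m) ℝ} {v e : ℕ → Agg m n} {c : ℝ}

/-- Unrolling the recursion: each perturbation is passed on by doubly stochastic matrices, which do not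
increase its norm. -/
lemma frob_consensusError_unroll (hW : ∀ k, DoublyStochastic (W k)) (hc0 : 0 ≤ c) (hc1 : c ≤ 1)
    (hv : ∀ k, v (k + 1) = c • mix (W k) (v k) + e k) (k t : ℕ) :
    frob (consensusError (v (k + t + 1))
        - c ^ (t + 1) • mix (windowProd W (k + t) (t + 1)) (consensusError (v k)))
      ≤ ∑ r ∈ Finset.range (t + 1), frob (consensusError (e (k + r))) := by
  induction t with
  | zero =>
    have h : windowProd W k 1 = W k := by simp [windowProd]
    simp [h, hv k, consensusError_add, consensusError_smul, (hW k).consensusError_mix]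
  | succ t ih =>
    rw [Finset.sum_range_succ]
    have h : consensusError (v (k + (t + 1) + 1))
        - c ^ (t + 1 + 1) • mix (windowProd W (k + (t + 1)) (t + 1 + 1)) (consensusError (v k))
        = c • mix (W (k + t + 1)) (consensusError (v (k + t + 1))
            - c ^ (t + 1) • mix (windowProd W (k + t) (t + 1)) (consensusError (v k)))
          + consensusError (e (k + (t + 1))) := by
      rw [← add_assoc, windowProd_succ, hv (k + t + 1), consensusError_add, consensusError_smul,
        (hW _).consensusError_mix, mix_mul, mix_sub, mix_smul, smul_sub, smul_smul, ← pow_succ']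
      abel
    rw [h]
    refine (frob_add_le _ _).trans (add_le_add_left (le_trans ?_ ih) _)
    rw [frob_smul, abs_of_nonneg hc0]
    refine (mul_le_of_le_one_left (frob_nonneg _) hc1).trans ?_
    exact (hW _).frob_mix_le _

/-- Over one window, the squared consensus error of a perturbed averaging recursion contracts by the
joint spectral constant, up to the accumulated perturbations. -/
lemma frobSq_consensusError_window (hm : 0 < m) {γ : ℕ} (hγ : 1 ≤ γ) {σ : ℝ}
    (hσ : jointSigma W γ ≤ σ) (hσ1 : σ < 1)
    (hW : ∀ k, DoublyStochastic (W k)) (hc0 : 0 ≤ c) (hc1 : c ≤ 1)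
    (hv : ∀ k, v (k + 1) = c • mix (W k) (v k) + e k) (k : ℕ) :
    frobSq (consensusError (v (k + γ))) ≤ σ * frobSq (consensusError (v k))
      + γ / (1 - σ) * ∑ r ∈ Finset.range γ, frobSq (consensusError (e (k + r))) := by
  obtain ⟨t, rfl⟩ : ∃ t, γ = t + 1 := ⟨γ - 1, by omega⟩
  have hσ0 : 0 ≤ σ := (jointSigma_nonneg _ _).trans hσ
  have h1 := frob_consensusError_unroll hW hc0 hc1 hv k t
  set b := ∑ r ∈ Finset.range (t + 1), frob (consensusError (e (k + r))) with hb
  set a := frob (consensusError (v k)) with ha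
  have ha0 : 0 ≤ a := frob_nonneg _
  have hb0 : 0 ≤ b := Finset.sum_nonneg fun _ _ => frob_nonneg _
  have h2 : frob (c ^ (t + 1) • mix (windowProd W (k + t) (t + 1)) (consensusError (v k)))
      ≤ σ * a := by
    rw [frob_smul, abs_of_nonneg (by positivity)]
    refine (mul_le_of_le_one_left (frob_nonneg _) (pow_le_one₀ hc0 hc1)).trans ?_
    refine (frob_mix_window_le hm hW (by omega) _).trans ?_
    exact mul_le_mul_of_nonneg_right hσ ha0
  have h3 : frob (consensusError (v (k + (t + 1)))) ≤ σ * a + b := by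
    have := frob_add_le
      (c ^ (t + 1) • mix (windowProd W (k + t) (t + 1)) (consensusError (v k)))
      (consensusError (v (k + t + 1))
        - c ^ (t + 1) • mix (windowProd W (k + t) (t + 1)) (consensusError (v k)))
    rw [add_sub_cancel] at this
    rw [← add_assoc]
    linarith
  have hδ : 0 < 1 - σ := by linarith
  -- Convexity of the square, with weights `σ` and `1 - σ` at `a` and `b / (1 - σ)`.
  have h4 : (σ * a + b) ^ 2 ≤ σ * a ^ 2 + b ^ 2 / (1 - σ) := by
    have : σ * a ^ 2 + b ^ 2 / (1 - σ) - (σ * a + b) ^ 2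
        = σ / (1 - σ) * ((1 - σ) * a - b) ^ 2 := by
      field_simp; ring
    have h5 : 0 ≤ σ / (1 - σ) * ((1 - σ) * a - b) ^ 2 := by positivity
    linarith
  have h5 : b ^ 2 ≤ (t + 1 : ℕ) * ∑ r ∈ Finset.range (t + 1),
      frobSq (consensusError (e (k + r))) := by
    have := sq_sum_le_card_mul_sum_sq (s := Finset.range (t + 1))
      (f := fun r => frob (consensusError (e (k + r))))
    simpa [frob_sq] using this
  rw [← frob_sq, ← frob_sq (consensusError (v k))]
  calc frob (consensusError (v (k + (t + 1)))) ^ 2 ≤ (σ * a + b) ^ 2 := by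
        gcongr; exact frob_nonneg _
    _ ≤ σ * a ^ 2 + b ^ 2 / (1 - σ) := h4
    _ ≤ _ := by
        rw [div_mul_eq_mul_div]
        gcongr

end Recursion

/-! ### Smooth strongly convex functions -/

section Local

variable {n : ℕ} {μ L : ℝ} {g : Vec n → ℝ}

lemma StronglyConvex.convex (hμ : 0 ≤ μ) (hg : StronglyConvex μ g) (x y : Vec n) :
    g x + ⟪gradient g x, y - x⟫_ℝ ≤ g y := by
  have h1 := hg x y
  have h2 : 0 ≤ μ / 2 * ‖y - x‖ ^ 2 := by positivity
  linarith

lemma StronglyConvex.le_smooth (hn : 0 < n) (hg : StronglyConvex μ g) (hL : Smooth L g) :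
    μ ≤ L := by
  set e : Vec n := EuclideanSpace.single ⟨0, hn⟩ 1
  have he : ‖e‖ = 1 := by simp [e]
  have h1 := hg 0 e
  have h2 := hg e 0
  have h3 := hL.2 0 e
  have h4 := real_inner_le_norm (gradient g e - gradient g 0) e
  rw [inner_sub_left] at h4
  simp only [sub_zero, zero_sub, inner_neg_right, norm_neg, he] at h1 h2 h3 h4
  linarith

/-- A quadratic upper bound, obtained from convexity at the endpoint `y`. This argument needs no
integration along the segment and loses a factor `2` against the optimal constant `L / 2`. -/
lemma StronglyConvex.upper_bound (hμ : 0 ≤ μ) (hg : StronglyConvex μ g) (hL : Smooth L g)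
    (x y : Vec n) : g y ≤ g x + ⟪gradient g x, y - x⟫_ℝ + L * ‖y - x‖ ^ 2 := by
  have h1 := hg.convex hμ y x
  have h2 := real_inner_le_norm (gradient g y - gradient g x) (y - x)
  have h3 := mul_le_mul_of_nonneg_right (hL.2 x y) (norm_nonneg (y - x))
  rw [← neg_sub y x, inner_neg_right] at h1
  rw [inner_sub_left] at h2
  nlinarith

/-- Cocoercivity of the gradient: compare the convex lower bound from `y` with the quadratic upper
bound from `w`, at the point reached from `w` by a gradient step of length `1 / (2 L)`. -/
lemma StronglyConvex.cocoercive (hμ : 0 ≤ μ) (hL0 : 0 < L) (hg : StronglyConvex μ g)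
    (hL : Smooth L g) (y w : Vec n) :
    g y + ⟪gradient g y, w - y⟫_ℝ + 1 / (4 * L) * ‖gradient g w - gradient g y‖ ^ 2 ≤ g w := by
  set d := gradient g w - gradient g y with hd
  set u := w - (1 / (2 * L)) • d with hu
  have h1 := hg.convex hμ y u
  have h2 := hg.upper_bound hμ hL w u
  have h3 : u - w = -((1 / (2 * L)) • d) := by rw [hu]; abel
  have h4 : u - y = (w - y) - (1 / (2 * L)) • d := by rw [hu]; abel
  have h5 : ⟪gradient g w, d⟫_ℝ = ⟪gradient g y, d⟫_ℝ + ‖d‖ ^ 2 := by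
    rw [← real_inner_self_eq_norm_sq, ← inner_add_left, hd]
    congr 1
    abel
  rw [h4, inner_sub_right, inner_smul_right] at h1
  rw [h3, inner_neg_right, inner_smul_right, h5, norm_neg, norm_smul, mul_pow,
    Real.norm_eq_abs, sq_abs] at h2
  have h6 : L * ((1 / (2 * L)) ^ 2 * ‖d‖ ^ 2) = 1 / (4 * L) * ‖d‖ ^ 2 := by field_simp; ring
  have h7 : 1 / (2 * L) * ‖d‖ ^ 2 = 2 * (1 / (4 * L) * ‖d‖ ^ 2) := by field_simp; ring
  rw [h6, mul_add, h7] at h2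
  linarith

end Local

/-! ### The average objective with an inexact oracle -/

section Oracle

variable {m n : ℕ} {μ L : ℝ} {f : Fin m → Vec n → ℝ}

/-- The value at `w` of the average of the linearizations of the local functions, the `i`-th one
being taken at the `i`-th row of `v`. -/
def linModel (f : Fin m → Vec n → ℝ) (v : Agg m n) (w : Vec n) : ℝ :=
  (1 / (m : ℝ)) * ∑ i, (f i (v i) + ⟪gradient (f i) (v i), w - v i⟫_ℝ)

/-- The squared distance between the aggregate gradient at the consensual point `w` and the
aggregate gradient at `v`. -/
def gradGap (f : Fin m → Vec n → ℝ) (v : Agg m n) (w : Vec n) : ℝ :=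
  frobSq (aggGradient f (fun _ => w) - aggGradient f v)

lemma linModel_eq (v : Agg m n) (w w' : Vec n) :
    linModel f v w' = linModel f v w + ⟪average (aggGradient f v), w' - w⟫_ℝ := by
  have h : ∀ i, f i (v i) + ⟪gradient (f i) (v i), w' - v i⟫_ℝ
      = f i (v i) + ⟪gradient (f i) (v i), w - v i⟫_ℝ + ⟪gradient (f i) (v i), w' - w⟫_ℝ := by
    intro i
    rw [add_assoc, ← inner_add_right]
    congr 3
    abel
  simp only [linModel, h, Finset.sum_add_distrib, average, aggGradient, real_inner_smul_left,
    sum_inner]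
  ring

/-- The averaged linearizations minorize the objective. The quadratic term survives at the average of
the rows because the average distance to the rows is at least the distance to their average. -/
lemma linModel_add_le (hm : 0 < m) (hμ : 0 ≤ μ) (hf : ∀ i, StronglyConvex μ (f i))
    (v : Agg m n) (w : Vec n) :
    linModel f v w + μ / 2 * ‖w - average v‖ ^ 2 ≤ (1 / (m : ℝ)) * ∑ i, f i w := by
  have h1 : ∑ i, (f i (v i) + ⟪gradient (f i) (v i), w - v i⟫_ℝ + μ / 2 * ‖w - v i‖ ^ 2)
      ≤ ∑ i, f i w := Finset.sum_le_sum fun i _ => hf i (v i) w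
  rw [Finset.sum_add_distrib, ← Finset.mul_sum, sum_norm_sub_sq hm] at h1
  have hm' : (0 : ℝ) < m := by exact_mod_cast hm
  have h2 := mul_nonneg hμ (frobSq_nonneg (consensusError v))
  have h3 : linModel f v w + μ / 2 * ‖w - average v‖ ^ 2
      = (1 / (m : ℝ)) * (∑ i, (f i (v i) + ⟪gradient (f i) (v i), w - v i⟫_ℝ)
        + μ / 2 * (m * ‖w - average v‖ ^ 2)) := by
    unfold linModel; field_simp
  rw [h3]
  refine mul_le_mul_of_nonneg_left ?_ (by positivity)
  linarith

lemma linModel_add_gradGap_le (hμ : 0 ≤ μ) (hL0 : 0 < L) (hf : ∀ i, StronglyConvex μ (f i))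
    (hL : ∀ i, Smooth L (f i)) (v : Agg m n) (w : Vec n) :
    linModel f v w + 1 / (4 * m * L) * gradGap f v w ≤ (1 / (m : ℝ)) * ∑ i, f i w := by
  have h1 : ∑ i, (f i (v i) + ⟪gradient (f i) (v i), w - v i⟫_ℝ
      + 1 / (4 * L) * ‖gradient (f i) w - gradient (f i) (v i)‖ ^ 2)
      ≤ ∑ i, f i w := Finset.sum_le_sum fun i _ => (hf i).cocoercive hμ hL0 (hL i) (v i) w
  rw [Finset.sum_add_distrib, ← Finset.mul_sum] at h1
  have h3 : linModel f v w + 1 / (4 * m * L) * gradGap f v w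
      = (1 / (m : ℝ)) * (∑ i, (f i (v i) + ⟪gradient (f i) (v i), w - v i⟫_ℝ)
        + 1 / (4 * L) * ∑ i, ‖gradient (f i) w - gradient (f i) (v i)‖ ^ 2) := by
    simp only [linModel, gradGap, frobSq, aggGradient, Pi.sub_apply]
    ring
  rw [h3]
  exact mul_le_mul_of_nonneg_left h1 (by positivity)

/-- The averaged linearizations majorize the objective up to a quadratic term and the consensus error
of the points of linearization. -/
lemma le_linModel_add (hm : 0 < m) (hμ : 0 ≤ μ) (hf : ∀ i, StronglyConvex μ (f i))
    (hL : ∀ i, Smooth L (f i)) (v : Agg m n) (w : Vec n) :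
    (1 / (m : ℝ)) * ∑ i, f i w ≤ linModel f v w + L * ‖w - average v‖ ^ 2
      + L / m * frobSq (consensusError v) := by
  have h1 : ∑ i, f i w ≤
      ∑ i, (f i (v i) + ⟪gradient (f i) (v i), w - v i⟫_ℝ + L * ‖w - v i‖ ^ 2) :=
    Finset.sum_le_sum fun i _ => (hf i).upper_bound hμ (hL i) (v i) w
  rw [Finset.sum_add_distrib, ← Finset.mul_sum, sum_norm_sub_sq hm] at h1
  have hm' : (0 : ℝ) < m := by exact_mod_cast hm
  have h3 : linModel f v w + L * ‖w - average v‖ ^ 2 + L / m * frobSq (consensusError v)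
      = (1 / (m : ℝ)) * (∑ i, (f i (v i) + ⟪gradient (f i) (v i), w - v i⟫_ℝ)
        + L * (m * ‖w - average v‖ ^ 2 + frobSq (consensusError v))) := by
    unfold linModel; field_simp; ring
  rw [h3]
  exact mul_le_mul_of_nonneg_left h1 (by positivity)

/-- Smoothness bounds the gradient gap. -/
lemma gradGap_le (hm : 0 < m) (hL : ∀ i, Smooth L (f i)) (v : Agg m n)
    (w : Vec n) :
    gradGap f v w ≤ L ^ 2 * (m * ‖w - average v‖ ^ 2 + frobSq (consensusError v)) := by
  rw [← sum_norm_sub_sq hm, Finset.mul_sum, gradGap, frobSq]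
  refine Finset.sum_le_sum fun i _ => ?_
  rw [← mul_pow]
  gcongr
  exact (hL i).2 (v i) w

/-- The change of the aggregate gradient from `v` to `v'` passes through a consensual point. -/
lemma frobSq_aggGradient_sub_le (v v' : Agg m n) (w : Vec n) :
    frobSq (aggGradient f v' - aggGradient f v) ≤ 2 * gradGap f v' w + 2 * gradGap f v w := by
  unfold gradGap frobSq
  rw [Finset.mul_sum, Finset.mul_sum, ← Finset.sum_add_distrib]
  refine Finset.sum_le_sum fun i _ => ?_
  simp only [Pi.sub_apply, aggGradient]
  have h := parallelogram_law_with_norm ℝ (gradient (f i) w - gradient (f i) (v i))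
    (gradient (f i) w - gradient (f i) (v' i))
  rw [sub_sub_sub_cancel_left] at h
  nlinarith [norm_nonneg (gradient (f i) w - gradient (f i) (v i)
    + (gradient (f i) w - gradient (f i) (v' i)))]

/-- One step of the accelerated method on the averages, with the inexact oracle given by `v`.
The point `Z'` is the proximal step written as a formula for the average gradient. -/
lemma accelerated_descent (hm : 0 < m) (hμ : 0 ≤ μ) (hL0 : 0 < L)
    (hf : ∀ i, StronglyConvex μ (f i)) (hL : ∀ i, Smooth L (f i)) {θ α : ℝ} (hθ0 : 0 ≤ θ)
    (hθ1 : θ ≤ 1) (v : Agg m n) {X Y Z X' Z' w : Vec n} (hv : average v = Y)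
    (hY : Y = θ • Z + (1 - θ) • X) (hX' : X' = θ • Z' + (1 - θ) • X)
    (hg : θ • average (aggGradient f v) = (θ ^ 2 / α) • (Z - Z') + (μ * θ) • (Y - Z')) :
    (1 / (m : ℝ)) * ∑ i, f i X' - (1 / (m : ℝ)) * ∑ i, f i w
        + (θ ^ 2 / (2 * α) + μ * θ / 2) * ‖Z' - w‖ ^ 2
      ≤ (1 - θ) * ((1 / (m : ℝ)) * ∑ i, f i X - (1 / (m : ℝ)) * ∑ i, f i w)
        + θ ^ 2 / (2 * α) * ‖Z - w‖ ^ 2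
        - (1 / (2 * α) - L) * (θ ^ 2 * ‖Z' - Z‖ ^ 2)
        - (1 - θ) / (4 * m * L) * gradGap f v X + L / m * frobSq (consensusError v) := by
  set g := average (aggGradient f v) with hgdef
  have h1 := le_linModel_add hm hμ hf hL v X'
  have h2 := linModel_add_gradGap_le hμ hL0 hf hL v X
  have h3 := linModel_add_le hm hμ hf v w
  rw [linModel_eq v Y] at h1 h2 h3
  rw [hv, ← hgdef] at h1
  rw [← hgdef] at h2
  rw [hv, ← hgdef] at h3
  have hd : X' - Y = θ • (Z' - Z) := by rw [hX', hY]; module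
  have hd2 : X' - Y = θ • (Z' - w) + θ • (w - Y) + (1 - θ) • (X - Y) := by
    rw [hX']; module
  have h4 : ‖X' - Y‖ ^ 2 = θ ^ 2 * ‖Z' - Z‖ ^ 2 := by
    rw [hd, norm_smul, mul_pow, Real.norm_eq_abs, sq_abs]
  have h5 : ⟪g, X' - Y⟫_ℝ = θ * ⟪g, Z' - w⟫_ℝ + θ * ⟪g, w - Y⟫_ℝ + (1 - θ) * ⟪g, X - Y⟫_ℝ := by
    rw [hd2, inner_add_right, inner_add_right, inner_smul_right, inner_smul_right,
      inner_smul_right]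
  -- Three-point identity.
  have three : ∀ A : Vec n, ⟪A - Z', Z' - w⟫_ℝ
      = (‖A - w‖ ^ 2 - ‖Z' - w‖ ^ 2 - ‖A - Z'‖ ^ 2) / 2 := by
    intro A
    have : A - w = (A - Z') + (Z' - w) := by abel
    rw [this, norm_add_sq_real]
    ring
  have h6 : θ * ⟪g, Z' - w⟫_ℝ
      = θ ^ 2 / α * ((‖Z - w‖ ^ 2 - ‖Z' - w‖ ^ 2 - ‖Z' - Z‖ ^ 2) / 2)
        + μ * θ * ((‖w - Y‖ ^ 2 - ‖Z' - w‖ ^ 2 - ‖Y - Z'‖ ^ 2) / 2) := by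
    rw [← real_inner_smul_left, hg, inner_add_left, real_inner_smul_left, real_inner_smul_left,
      three, three, norm_sub_rev Z' Z, norm_sub_rev w Y]
  have h7 := mul_le_mul_of_nonneg_left h2 (sub_nonneg.2 hθ1)
  have h8 := mul_le_mul_of_nonneg_left h3 hθ0
  have h9 : 0 ≤ μ * θ * ‖Y - Z'‖ ^ 2 := by positivity
  have e1 : θ ^ 2 / α = 2 * (θ ^ 2 / (2 * α)) := by
    rw [mul_comm 2 α, ← div_div]; ring
  have e2 : 1 / (2 * α) * (θ ^ 2 * ‖Z' - Z‖ ^ 2) = θ ^ 2 / (2 * α) * ‖Z' - Z‖ ^ 2 := by ring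
  have e3 : (1 - θ) / (4 * m * L) * gradGap f v X
      = (1 - θ) * (1 / (4 * m * L) * gradGap f v X) := by ring
  rw [sub_mul (1 / (2 * α)), e2, e3]
  rw [e1] at h6
  rw [h5, h6, h4] at h1
  linarith

end Oracle

/-! ### Weighted sums of windowed recursions -/

/-- If a nonnegative sequence `a` contracts by `σ` over each window of length `γ` up to
perturbations `b`, then its sum with the growing weights `p ^ k` is controlled by its first window
and by the weighted sum of the perturbations, as soon as `p ^ γ` is close enough to one for
`p ^ γ * σ` to stay away from one. -/
lemma weighted_sum_le {a b : ℕ → ℝ} {γ : ℕ} {σ p M : ℝ} (hγ : 1 ≤ γ)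
    (ha : ∀ k, 0 ≤ a k) (hb : ∀ k, 0 ≤ b k) (hσ0 : 0 ≤ σ) (hσ1 : σ < 1) (hp : 1 ≤ p)
    (hpσ : p ^ γ * σ ≤ 1 - 98 / 100 * (1 - σ)) (hpγ : p ^ γ ≤ 102 / 100)
    (hM : ∀ k < γ, a k ≤ M)
    (hrec : ∀ k, a (k + γ) ≤ σ * a k + γ / (1 - σ) * ∑ r ∈ Finset.range γ, b (k + r)) (K : ℕ) :
    ∑ k ∈ Finset.range (K + 1), p ^ k * a k ≤ 105 / 100 * (γ / (1 - σ) * M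
      + (γ / (1 - σ)) ^ 2 * ∑ k ∈ Finset.range K, p ^ k * b k) := by
  have hδ : 0 < 1 - σ := by linarith
  have hp0 : 0 ≤ p := by linarith
  set Sa := ∑ k ∈ Finset.range (K + 1), p ^ k * a k with hSa
  set Sb := ∑ k ∈ Finset.range K, p ^ k * b k with hSb
  have hSa0 : 0 ≤ Sa := Finset.sum_nonneg fun k _ => mul_nonneg (by positivity) (ha k)
  have hSb0 : 0 ≤ Sb := Finset.sum_nonneg fun k _ => mul_nonneg (by positivity) (hb k)
  have hM0 : 0 ≤ M := (ha 0).trans (hM 0 hγ)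
  have hγ0 : (0 : ℝ) < γ := by exact_mod_cast hγ
  have hinit : ∀ J ≤ γ, ∑ k ∈ Finset.range J, p ^ k * a k ≤ p ^ γ * (γ * M) := by
    intro J hJ
    calc ∑ k ∈ Finset.range J, p ^ k * a k ≤ ∑ k ∈ Finset.range γ, p ^ k * a k :=
          Finset.sum_le_sum_of_subset_of_nonneg (by simpa using hJ)
            fun k _ _ => mul_nonneg (by positivity) (ha k)
      _ ≤ ∑ k ∈ Finset.range γ, p ^ γ * M := by
          refine Finset.sum_le_sum fun k hk => ?_
          have hk' := Finset.mem_range.1 hk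
          exact mul_le_mul (pow_le_pow_right₀ hp hk'.le) (hM k hk') (ha k) (by positivity)
      _ = p ^ γ * (γ * M) := by simp; ring
  have main : Sa ≤ p ^ γ * (γ * M) + p ^ γ * σ * Sa
      + p ^ γ * (γ / (1 - σ) * (γ * Sb)) := by
    rcases le_total (K + 1) γ with h | h
    · have h1 := hinit _ h
      have h2 : 0 ≤ p ^ γ * σ * Sa := by positivity
      have h3 : 0 ≤ p ^ γ * (γ / (1 - σ) * (γ * Sb)) := by positivity
      linarith
    · obtain ⟨J, hJ⟩ := Nat.exists_eq_add_of_le h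
      have h1 := hinit γ le_rfl
      have h2 : ∑ k ∈ Finset.range J, p ^ k * a k ≤ Sa :=
        Finset.sum_le_sum_of_subset_of_nonneg (Finset.range_subset_range.2 (by omega))
          fun k _ _ => mul_nonneg (by positivity) (ha k)
      have h3 : ∀ r < γ, ∑ k ∈ Finset.range J, p ^ k * b (k + r) ≤ Sb := by
        intro r hr
        calc ∑ k ∈ Finset.range J, p ^ k * b (k + r)
            ≤ ∑ k ∈ Finset.range J, p ^ (k + r) * b (k + r) :=
              Finset.sum_le_sum fun k _ =>
                mul_le_mul_of_nonneg_right (pow_le_pow_right₀ hp (by omega)) (hb _)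
          _ ≤ Sb := by
              rw [Finset.range_eq_Ico, Finset.sum_Ico_add' (fun k => p ^ k * b k) 0 J r]
              refine Finset.sum_le_sum_of_subset_of_nonneg (fun x hx => ?_)
                fun k _ _ => mul_nonneg (by positivity) (hb k)
              simp only [Finset.mem_Ico, Finset.mem_range] at hx ⊢
              omega
      have h4 : ∑ k ∈ Finset.range J, p ^ (γ + k) * a (γ + k)
          ≤ p ^ γ * (σ * ∑ k ∈ Finset.range J, p ^ k * a k
            + γ / (1 - σ) * ∑ r ∈ Finset.range γ, ∑ k ∈ Finset.range J, p ^ k * b (k + r)) := by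
        rw [Finset.sum_comm, Finset.mul_sum, Finset.mul_sum, ← Finset.sum_add_distrib,
          Finset.mul_sum]
        refine Finset.sum_le_sum fun k _ => ?_
        rw [← Finset.mul_sum, pow_add, mul_assoc]
        refine mul_le_mul_of_nonneg_left ?_ (by positivity)
        have := mul_le_mul_of_nonneg_left (hrec k) (pow_nonneg hp0 k)
        rw [add_comm γ k]
        linarith
      have h5 : ∑ r ∈ Finset.range γ, ∑ k ∈ Finset.range J, p ^ k * b (k + r) ≤ γ * Sb := by
        calc _ ≤ ∑ r ∈ Finset.range γ, Sb :=
              Finset.sum_le_sum fun r hr => h3 r (Finset.mem_range.1 hr)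
          _ = γ * Sb := by simp
      have h6 : p ^ γ * (σ * ∑ k ∈ Finset.range J, p ^ k * a k
            + γ / (1 - σ) * ∑ r ∈ Finset.range γ, ∑ k ∈ Finset.range J, p ^ k * b (k + r))
          ≤ p ^ γ * (σ * Sa + γ / (1 - σ) * (γ * Sb)) := by gcongr
      have h7 : Sa = ∑ k ∈ Finset.range γ, p ^ k * a k
          + ∑ k ∈ Finset.range J, p ^ (γ + k) * a (γ + k) := by
        rw [hSa, hJ, Finset.sum_range_add]
      linarith
  have h1 : p ^ γ * σ * Sa ≤ (1 - 98 / 100 * (1 - σ)) * Sa :=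
    mul_le_mul_of_nonneg_right hpσ hSa0
  have h2 : p ^ γ * (γ * M) ≤ 102 / 100 * (γ * M) :=
    mul_le_mul_of_nonneg_right hpγ (by positivity)
  have h3 : p ^ γ * (γ / (1 - σ) * (γ * Sb)) ≤ 102 / 100 * (γ / (1 - σ) * (γ * Sb)) :=
    mul_le_mul_of_nonneg_right hpγ (by positivity)
  have h4 : 98 / 100 * ((1 - σ) * Sa)
      ≤ 102 / 100 * (γ * M) + 102 / 100 * (γ / (1 - σ) * (γ * Sb)) := by linarith
  have h5 : Sa ≤ 102 / 98 * (γ / (1 - σ) * M + (γ / (1 - σ)) ^ 2 * Sb) := by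
    have : γ / (1 - σ) * M + (γ / (1 - σ)) ^ 2 * Sb
        = (γ * M + γ / (1 - σ) * (γ * Sb)) / (1 - σ) := by field_simp
    rw [this, ← mul_div_assoc, le_div_iff₀ hδ]
    linarith
  have h6 : 0 ≤ γ / (1 - σ) * M + (γ / (1 - σ)) ^ 2 * Sb := by positivity
  linarith

namespace Setting

variable {m n : ℕ} (P : Setting m n)

/-! ### The iterates -/

/-- The extrapolated iterates `y^k`. -/
def y (k : ℕ) : Agg m n := (P.run k).val.y

lemma z_succ (k : ℕ) : P.z (k + 1) = (1 / (1 + P.μ * P.α / P.θ)) •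
    (mix (P.W₂ k) ((P.μ * P.α / P.θ) • P.y k + P.z k) - (P.α / P.θ) • P.s k) := rfl

lemma x_succ (k : ℕ) :
    P.x (k + 1) = P.θ • P.z (k + 1) + (1 - P.θ) • mix (P.W₃ k) (P.x k) := rfl

lemma y_eq (k : ℕ) : P.y k = P.θ • P.z k + (1 - P.θ) • P.x k := by
  cases k with
  | zero => change P.x₀ = P.θ • P.x₀ + (1 - P.θ) • P.x₀; module
  | succ k => rfl

lemma storedGradient_eq (k : ℕ) : (P.run k).val.g = aggGradient P.f (P.y k) := by
  cases k <;> rfl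

lemma s_zero : P.s 0 = aggGradient P.f (P.y 0) := rfl

lemma s_succ (k : ℕ) : P.s (k + 1) = mix (P.W₁ (k + 1)) (P.s k)
    + (aggGradient P.f (P.y (k + 1)) - aggGradient P.f (P.y k)) := by
  rw [← storedGradient_eq P k, ← add_sub_assoc]; rfl

lemma grads_run (k : ℕ) : (P.run k).grads = k + 1 := by
  induction k with
  | zero => rfl
  | succ k ih =>
    have h : (P.run (k + 1)).grads = (P.run k).grads + 1 := rfl
    omega

lemma comms_run (k : ℕ) : (P.run k).comms = 3 * k := by
  induction k with
  | zero => rfl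
  | succ k ih =>
    have h : (P.run (k + 1)).comms = (P.run k).comms + 3 := rfl
    omega

/-- The potential function of the accelerated method, evaluated at the averages. -/
def potential (k : ℕ) : ℝ :=
  P.F (average (P.x k)) - P.F P.xstar
    + (P.θ ^ 2 / (2 * P.α) + P.μ * P.θ / 2) * ‖average (P.z k) - P.xstar‖ ^ 2

/-- The squared consensus error of `x^k`. -/
def errX (k : ℕ) : ℝ := frobSq (consensusError (P.x k))

/-- The squared consensus error of `y^k`. -/
def errY (k : ℕ) : ℝ := frobSq (consensusError (P.y k))

/-- The squared consensus error of `θ z^k`, the form in which `z` enters `x` and `y`. -/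
def errZ (k : ℕ) : ℝ := P.θ ^ 2 * frobSq (consensusError (P.z k))

/-- The squared consensus error of `s^k`. -/
def errS (k : ℕ) : ℝ := frobSq (consensusError (P.s k))

/-- The squared movement of the average of `θ z` in one step, that is, the squared distance from the
average of `y^k` to the average of `x^(k+1)`. -/
def moveZ (k : ℕ) : ℝ := P.θ ^ 2 * ‖average (P.z (k + 1)) - average (P.z k)‖ ^ 2

/-- The gradient gap between the average of `x^k` and the rows of `y^k`. -/
def gap (k : ℕ) : ℝ := gradGap P.f (P.y k) (average (P.x k))

lemma errX_nonneg (k : ℕ) : 0 ≤ P.errX k := frobSq_nonneg _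
lemma errY_nonneg (k : ℕ) : 0 ≤ P.errY k := frobSq_nonneg _
lemma errZ_nonneg (k : ℕ) : 0 ≤ P.errZ k := mul_nonneg (sq_nonneg _) (frobSq_nonneg _)
lemma errS_nonneg (k : ℕ) : 0 ≤ P.errS k := frobSq_nonneg _
lemma moveZ_nonneg (k : ℕ) : 0 ≤ P.moveZ k := by unfold moveZ; positivity
lemma gap_nonneg (k : ℕ) : 0 ≤ P.gap k := frobSq_nonneg _

/-! ### Bounds on the parameters -/

/-- The condition number `γ / (1 - σ)` of the network. -/
def networkCond : ℝ := P.γ / (1 - P.σ)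

section Parameters

variable {P} (A : P.Assumptions)
include A

omit A in
variable (P) in
lemma σ_nonneg : 0 ≤ P.σ :=
  (jointSigma_nonneg P.W₁ P.γ).trans (le_max_left _ _)

lemma Assumptions.σ_lt_one : P.σ < 1 :=
  max_lt A.weights₁.joint_spectrum (max_lt A.weights₂.joint_spectrum A.weights₃.joint_spectrum)

lemma Assumptions.μ_le_L : P.μ ≤ P.L :=
  (A.stronglyConvex ⟨0, A.m_pos⟩).le_smooth A.n_pos (A.smooth ⟨0, A.m_pos⟩)

lemma Assumptions.L_pos : 0 < P.L := A.μ_pos.trans_le A.μ_le_L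

lemma Assumptions.γ_le_networkCond : (P.γ : ℝ) ≤ P.networkCond := by
  have h0 := P.σ_nonneg
  have h1 := A.σ_lt_one
  rw [networkCond, le_div_iff₀ (by linarith)]
  have : (0 : ℝ) ≤ P.γ := by positivity
  nlinarith

lemma Assumptions.one_le_networkCond : 1 ≤ P.networkCond :=
  le_trans (by exact_mod_cast P.one_le_γ) A.γ_le_networkCond

lemma Assumptions.maxStep_eq : P.maxStep = 1 / (4244 * P.L * P.networkCond ^ 3) := by
  have h1 := A.σ_lt_one
  have h2 : (1 - P.σ) ≠ 0 := by linarith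
  have h3 : (P.γ : ℝ) ≠ 0 := by have := P.one_le_γ; positivity
  have h4 := A.L_pos.ne'
  rw [maxStep, networkCond]
  field_simp

end Parameters

/-- The standing assumptions together with an admissible step size. -/
structure Admissible : Prop extends P.Assumptions where
  α_pos : 0 < P.α
  α_le : P.α ≤ P.maxStep

namespace Admissible

variable {P} (A : P.Admissible)
include A

lemma α_mul_L_le : P.α * P.L * P.networkCond ^ 3 ≤ 1 / 4244 := by
  have h1 := A.α_le
  have hN := A.one_le_networkCond
  have hL := A.L_pos
  rw [A.maxStep_eq, le_div_iff₀ (by positivity)] at h1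
  linarith

lemma θ_sq : P.θ ^ 2 = P.μ * P.α / 4 := by
  have := mul_pos A.μ_pos A.α_pos
  rw [θ, div_pow, Real.sq_sqrt this.le]
  norm_num

lemma θ_pos : 0 < P.θ := by
  have := mul_pos A.μ_pos A.α_pos
  unfold θ; positivity

lemma θ_mul_networkCond_le : P.θ * P.networkCond ≤ 1 / 130 := by
  have hN := A.one_le_networkCond
  have h1 := A.α_mul_L_le
  have hθ := A.θ_pos
  refine abs_le_of_sq_le_sq' ?_ (by norm_num) |>.2
  rw [mul_pow, A.θ_sq]
  have h2 : P.μ * P.α * P.networkCond ^ 2 ≤ P.α * P.L * P.networkCond ^ 3 := by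
    have h3 : P.μ * P.α * P.networkCond ^ 2 ≤ P.L * P.α * P.networkCond ^ 2 := by
      have := A.μ_le_L
      have := A.α_pos
      gcongr
    have h4 : P.L * P.α * P.networkCond ^ 2 ≤ P.L * P.α * P.networkCond ^ 3 := by
      have := A.L_pos
      have := A.α_pos
      gcongr
      · norm_num
    linarith
  linarith

lemma θ_le : P.θ ≤ 1 / 130 := by
  have hN := A.one_le_networkCond
  have := A.θ_mul_networkCond_le
  nlinarith [A.θ_pos]

/-- Over one window the growth of the weights `(1 - θ)⁻¹ ^ k` is small against the spectral gap. -/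
lemma pow_γ_bounds :
    ((1 - P.θ)⁻¹) ^ P.γ * P.σ ≤ 1 - 98 / 100 * (1 - P.σ) ∧ ((1 - P.θ)⁻¹) ^ P.γ ≤ 102 / 100 := by
  have hσ0 := P.σ_nonneg
  have hσ1 := A.σ_lt_one
  have hθ := A.θ_le
  have h1 : 1 - (1 - P.σ) / 130 ≤ (1 - P.θ) ^ P.γ := by
    have h2 := one_add_mul_le_pow (a := -P.θ) (by linarith) P.γ
    have h3 := A.θ_mul_networkCond_le
    rw [networkCond, ← mul_div_assoc, div_le_iff₀ (by linarith)] at h3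
    rw [← sub_eq_add_neg] at h2
    linarith
  have hpos : 0 < (1 - P.θ) ^ P.γ := by linarith
  rw [inv_pow]
  constructor
  · rw [inv_mul_le_iff₀ hpos]
    nlinarith
  · rw [inv_le_iff_one_le_mul₀ hpos]
    linarith

/-! ### One step of the method -/

/-- Gradient tracking: mixing preserves averages and the increments telescope. -/
lemma average_s (k : ℕ) : average (P.s k) = average (aggGradient P.f (P.y k)) := by
  induction k with
  | zero => rw [s_zero]
  | succ k ih =>
    rw [s_succ, average_add, (A.weights₁.doublyStochastic _).average_mix, ih, average_sub]
    abel

lemma average_x_succ (k : ℕ) :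
    average (P.x (k + 1)) = P.θ • average (P.z (k + 1)) + (1 - P.θ) • average (P.x k) := by
  rw [x_succ, average_add, average_smul, average_smul,
    (A.weights₃.doublyStochastic _).average_mix]

omit A in
lemma average_y (k : ℕ) :
    average (P.y k) = P.θ • average (P.z k) + (1 - P.θ) • average (P.x k) := by
  rw [y_eq, average_add, average_smul, average_smul]

/-- The update of `z`, solved for the average gradient. -/
lemma proximal_average (k : ℕ) : P.θ • average (aggGradient P.f (P.y k))
    = (P.θ ^ 2 / P.α) • (average (P.z k) - average (P.z (k + 1)))
      + (P.μ * P.θ) • (average (P.y k) - average (P.z (k + 1))) := by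
  have hθ := A.θ_pos
  have hα := A.α_pos
  have hμ := A.μ_pos
  rw [z_succ, average_smul, average_sub, (A.weights₂.doublyStochastic _).average_mix,
    average_add, average_smul, average_smul, A.average_s]
  match_scalars <;> field_simp <;> ring

/-- One step decreases the potential by the factor `1 - θ`, up to the consensus error of `y`. -/
lemma potential_succ_le (k : ℕ) : P.potential (k + 1) ≤ (1 - P.θ) * P.potential k
    - (1 / (2 * P.α) - P.L) * P.moveZ k - (1 - P.θ) / (4 * m * P.L) * P.gap k
    + P.L / m * P.errY k := by
  have hθ := A.θ_pos
  have hθ1 := A.θ_le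
  have hα := A.α_pos
  have hμ := A.μ_pos
  have h := accelerated_descent A.m_pos hμ.le A.L_pos A.stronglyConvex A.smooth hθ.le
    (by linarith) (P.y k) (w := P.xstar) rfl (average_y k) (A.average_x_succ k)
    (A.proximal_average k)
  -- Strong convexity pays for the factor `1 - θ` on the distance term, since `θ ^ 2 = μ * α / 4`.
  have h1 : P.θ ^ 2 / (2 * P.α) ≤ (1 - P.θ) * (P.θ ^ 2 / (2 * P.α) + P.μ * P.θ / 2) := by
    have e : P.θ ^ 2 / (2 * P.α) = P.μ / 8 := by rw [A.θ_sq]; field_simp; norm_num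
    rw [e]
    nlinarith [mul_pos hμ hθ]
  have h2 := mul_le_mul_of_nonneg_right h1 (sq_nonneg ‖average (P.z k) - P.xstar‖)
  unfold potential moveZ gap errY F
  linarith

/-! ### Consensus errors over one window -/

lemma errY_le (k : ℕ) : P.errY k ≤ 2 * P.errX k + 2 * P.errZ k := by
  have hθ := A.θ_pos
  have hθ1 := A.θ_le
  have h1 := frobSq_add_le (P.θ • consensusError (P.z k)) ((1 - P.θ) • consensusError (P.x k))
  rw [frobSq_smul, frobSq_smul, ← consensusError_smul, ← consensusError_smul,
    ← consensusError_add, ← y_eq] at h1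
  have h2 : (1 - P.θ) ^ 2 * frobSq (consensusError (P.x k)) ≤ frobSq (consensusError (P.x k)) :=
    mul_le_of_le_one_left (frobSq_nonneg _) (pow_le_one₀ (by linarith) (by linarith))
  unfold errX errY errZ
  linarith

lemma aggGradient_sub_le (k : ℕ) :
    frobSq (consensusError (aggGradient P.f (P.y (k + 1)) - aggGradient P.f (P.y k)))
      ≤ 2 * P.gap (k + 1) + 2 * P.L ^ 2 * (m * P.moveZ k + P.errY k) := by
  refine (frobSq_consensusError_le A.m_pos _).trans ?_
  refine (frobSq_aggGradient_sub_le _ _ (average (P.x (k + 1)))).trans ?_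
  have h := gradGap_le A.m_pos A.smooth (P.y k) (average (P.x (k + 1)))
  have e : average (P.x (k + 1)) - average (P.y k)
      = P.θ • (average (P.z (k + 1)) - average (P.z k)) := by
    rw [A.average_x_succ, average_y]; module
  rw [e, norm_smul, mul_pow, Real.norm_eq_abs, sq_abs] at h
  unfold gap moveZ errY
  linarith

lemma errX_window (k : ℕ) : P.errX (k + P.γ) ≤ P.σ * P.errX k
    + P.γ / (1 - P.σ) * ∑ r ∈ Finset.range P.γ, P.errZ (k + r + 1) := by
  have hθ := A.θ_pos
  have hθ1 := A.θ_le
  have h := frobSq_consensusError_window A.m_pos P.one_le_γ (W := P.W₃) (σ := P.σ)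
    (v := P.x) (e := fun k => P.θ • P.z (k + 1)) (c := 1 - P.θ)
    ((le_max_right _ _).trans (le_max_right _ _)) A.σ_lt_one A.weights₃.doublyStochastic
    (by linarith) (by linarith) (fun k => by rw [x_succ, add_comm]) k
  simp only [consensusError_smul, frobSq_smul] at h
  exact h

lemma errS_window (k : ℕ) : P.errS (k + P.γ) ≤ P.σ * P.errS k
    + P.γ / (1 - P.σ) * ∑ r ∈ Finset.range P.γ,
      (2 * P.gap (k + r + 1) + 2 * P.L ^ 2 * (m * P.moveZ (k + r) + P.errY (k + r))) := by
  have hσ := A.σ_lt_one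
  have h := frobSq_consensusError_window A.m_pos P.one_le_γ (W := fun k => P.W₁ (k + 1))
    (σ := P.σ) (v := P.s)
    (e := fun k => aggGradient P.f (P.y (k + 1)) - aggGradient P.f (P.y k)) (c := 1)
    ((jointSigma_shift_le A.m_pos A.weights₁.doublyStochastic _).trans (le_max_left _ _))
    hσ (fun k => A.weights₁.doublyStochastic _) zero_le_one le_rfl
    (fun k => by rw [s_succ, one_smul]) k
  refine h.trans ?_
  unfold errS
  have : 0 ≤ 1 - P.σ := by linarith
  gcongr with r
  exact A.aggGradient_sub_le _

lemma errZ_window (k : ℕ) : P.errZ (k + P.γ) ≤ P.σ * P.errZ k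
    + P.γ / (1 - P.σ) * ∑ r ∈ Finset.range P.γ,
      (2 * P.α ^ 2 * (P.L ^ 2 * P.errY (k + r) + P.errS (k + r))) := by
  have hσ := A.σ_lt_one
  have hθ := A.θ_pos
  have hμ := A.μ_pos
  have hα := A.α_pos
  set β := P.μ * P.α / P.θ with hβ
  have hβ0 : 0 < β := by positivity
  set c := 1 / (1 + β) with hc
  have hc0 : 0 ≤ c := by positivity
  have hc1 : c ≤ 1 := by rw [hc, div_le_one (by positivity)]; linarith
  set e : ℕ → Agg m n := fun k => c • (β • mix (P.W₂ k) (P.y k) - (P.α / P.θ) • P.s k) with he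
  have h := frobSq_consensusError_window A.m_pos P.one_le_γ (W := P.W₂) (σ := P.σ)
    (v := P.z) (e := e) (c := c)
    ((le_max_left _ _).trans (le_max_right _ _)) A.σ_lt_one A.weights₂.doublyStochastic
    hc0 hc1 (fun k => by
      rw [z_succ, mix_add, mix_smul, he, ← smul_add]
      congr 1
      abel) k
  have hb : ∀ j, P.θ ^ 2 * frobSq (consensusError (e j))
      ≤ 2 * P.α ^ 2 * (P.L ^ 2 * P.errY j + P.errS j) := by
    intro j
    have h1 : frobSq (consensusError (e j))
        ≤ 2 * (β ^ 2 * P.errY j) + 2 * ((P.α / P.θ) ^ 2 * P.errS j) := by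
      have h2 : frobSq (consensusError (e j))
          ≤ frobSq (β • mix (P.W₂ j) (consensusError (P.y j))
            + (-(P.α / P.θ)) • consensusError (P.s j)) := by
        rw [he]
        simp only [consensusError_smul, consensusError_sub,
          (A.weights₂.doublyStochastic _).consensusError_mix]
        rw [frobSq_smul, neg_smul, ← sub_eq_add_neg]
        exact mul_le_of_le_one_left (frobSq_nonneg _) (pow_le_one₀ hc0 hc1)
      refine h2.trans ((frobSq_add_le _ _).trans ?_)
      rw [frobSq_smul, frobSq_smul, neg_sq]
      unfold errY errS
      gcongr
      exact (A.weights₂.doublyStochastic j).sum_norm_sq_le _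
    have h3 := mul_le_mul_of_nonneg_left h1 (sq_nonneg P.θ)
    have h4 : P.θ ^ 2 * (2 * (β ^ 2 * P.errY j) + 2 * ((P.α / P.θ) ^ 2 * P.errS j))
        = 2 * P.α ^ 2 * (P.μ ^ 2 * P.errY j + P.errS j) := by
      rw [hβ]; field_simp
    rw [h4] at h3
    refine h3.trans ?_
    have := A.μ_le_L
    have := P.errY_nonneg j
    gcongr
  have h5 := mul_le_mul_of_nonneg_left h (sq_nonneg P.θ)
  have h6 : P.θ ^ 2 * (P.σ * frobSq (consensusError (P.z k)) + P.γ / (1 - P.σ) *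
      ∑ r ∈ Finset.range P.γ, frobSq (consensusError (e (k + r))))
      = P.σ * P.errZ k + P.γ / (1 - P.σ) *
      ∑ r ∈ Finset.range P.γ, P.θ ^ 2 * frobSq (consensusError (e (k + r))) := by
    rw [← Finset.mul_sum]; unfold errZ; ring
  rw [h6] at h5
  refine h5.trans ?_
  have : 0 ≤ 1 - P.σ := by linarith
  refine add_le_add_right (mul_le_mul_of_nonneg_left ?_ (by positivity)) _
  exact Finset.sum_le_sum fun r _ => hb _

end Admissible

/-! ### Summation -/

/-- Sum with the growing weights `(1 - θ)⁻¹ ^ k` of the values of a sequence at `1, …, K`. -/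
def wsum (a : ℕ → ℝ) (K : ℕ) : ℝ := ∑ k ∈ Finset.range K, ((1 - P.θ)⁻¹) ^ k * a (k + 1)

lemma le_windowMax (a : ℕ → ℝ) {k : ℕ} (hk : k < P.γ) : a (k + 1) ≤ P.windowMax a :=
  Finset.le_sup' a (Finset.mem_Icc.2 ⟨by omega, by omega⟩)

lemma wsum_add (a b : ℕ → ℝ) (K : ℕ) :
    P.wsum (fun k => a k + b k) K = P.wsum a K + P.wsum b K := by
  simp [wsum, mul_add, Finset.sum_add_distrib]

lemma wsum_mul (c : ℝ) (a : ℕ → ℝ) (K : ℕ) :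
    P.wsum (fun k => c * a k) K = c * P.wsum a K := by
  simp only [wsum, Finset.mul_sum, mul_left_comm]

namespace Admissible

variable {P} (A : P.Admissible)
include A

lemma one_le_inv : 1 ≤ (1 - P.θ)⁻¹ :=
  (one_le_inv₀ (by linarith [A.θ_le])).2 (by linarith [A.θ_pos])

lemma wsum_nonneg {a : ℕ → ℝ} (ha : ∀ k, 0 ≤ a k) (K : ℕ) : 0 ≤ P.wsum a K :=
  Finset.sum_nonneg fun k _ =>
    mul_nonneg (pow_nonneg (zero_le_one.trans A.one_le_inv) k) (ha _)

lemma wsum_mono {a b : ℕ → ℝ} (hab : ∀ k, a k ≤ b k) (K : ℕ) : P.wsum a K ≤ P.wsum b K :=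
  Finset.sum_le_sum fun k _ => mul_le_mul_of_nonneg_left (hab _)
    (pow_nonneg (zero_le_one.trans A.one_le_inv) k)

lemma wsum_le_succ {a : ℕ → ℝ} (ha : ∀ k, 0 ≤ a k) (K : ℕ) :
    P.wsum a K ≤ P.wsum a (K + 1) := by
  unfold wsum
  rw [Finset.sum_range_succ]
  exact le_add_of_nonneg_right
    (mul_nonneg (pow_nonneg (zero_le_one.trans A.one_le_inv) K) (ha _))

/-- The weights grow, so a shifted sequence has a smaller sum. -/
lemma wsum_shift_le {a : ℕ → ℝ} (ha : ∀ k, 0 ≤ a k) (K : ℕ) :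
    P.wsum (fun k => a (k + 1)) K ≤ P.wsum a (K + 1) := by
  have hp := A.one_le_inv
  unfold wsum
  rw [Finset.sum_range_succ']
  refine le_add_of_le_of_nonneg (Finset.sum_le_sum fun k _ => ?_)
    (mul_nonneg (by positivity) (ha _))
  exact mul_le_mul_of_nonneg_right (pow_le_pow_right₀ hp (by omega)) (ha _)

/-- The weighted sum of a windowed recursion that holds from index one on. -/
lemma wsum_le_of_window {a b : ℕ → ℝ} (ha : ∀ k, 0 ≤ a k) (hb : ∀ k, 0 ≤ b k)
    (hrec : ∀ k, a (k + P.γ) ≤ P.σ * a k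
      + P.γ / (1 - P.σ) * ∑ r ∈ Finset.range P.γ, b (k + r)) (K : ℕ) :
    P.wsum a (K + 1) ≤ 105 / 100 * (P.networkCond * P.windowMax a
      + P.networkCond ^ 2 * P.wsum b K) := by
  obtain ⟨h1, h2⟩ := A.pow_γ_bounds
  refine weighted_sum_le (a := fun k => a (k + 1)) (b := fun k => b (k + 1)) P.one_le_γ
    (fun k => ha _) (fun k => hb _) P.σ_nonneg A.σ_lt_one A.one_le_inv h1 h2
    (fun k hk => P.le_windowMax a hk) (fun k => ?_) K
  have := hrec (k + 1)
  simpa only [add_right_comm] using this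

lemma wsum_errX_le (K : ℕ) : P.wsum P.errX (K + 1) ≤ 105 / 100 * (P.networkCond * P.Mx
    + P.networkCond ^ 2 * P.wsum P.errZ (K + 1)) := by
  refine (A.wsum_le_of_window (b := fun k => P.errZ (k + 1)) P.errX_nonneg
    (fun k => P.errZ_nonneg _) A.errX_window K).trans ?_
  have h := A.wsum_shift_le P.errZ_nonneg K
  have hN := A.one_le_networkCond
  unfold Mx errX
  gcongr

lemma wsum_errZ_le (K : ℕ) : P.wsum P.errZ (K + 1) ≤ 105 / 100 * (P.networkCond * P.Mz
    + P.networkCond ^ 2 * (2 * P.α ^ 2 *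
      (P.L ^ 2 * P.wsum P.errY (K + 1) + P.wsum P.errS (K + 1)))) := by
  have hY := P.errY_nonneg
  have hS := P.errS_nonneg
  have hb : ∀ k, 0 ≤ 2 * P.α ^ 2 * (P.L ^ 2 * P.errY k + P.errS k) := fun k => by
    have := hY k
    have := hS k
    positivity
  refine (A.wsum_le_of_window P.errZ_nonneg hb A.errZ_window K).trans ?_
  have h := A.wsum_le_succ hb K
  rw [wsum_mul P (2 * P.α ^ 2) (fun k => P.L ^ 2 * P.errY k + P.errS k) (K + 1), wsum_add,
    wsum_mul P (P.L ^ 2)] at h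
  have hN := A.one_le_networkCond
  unfold Mz errZ at *
  gcongr

lemma wsum_errS_le (K : ℕ) : P.wsum P.errS (K + 1) ≤ 105 / 100 * (P.networkCond * P.Ms
    + P.networkCond ^ 2 * (2 * P.wsum P.gap (K + 1) + 2 * P.L ^ 2 *
      (m * P.wsum P.moveZ (K + 1) + P.wsum P.errY (K + 1)))) := by
  have hY := P.errY_nonneg
  have hG := P.gap_nonneg
  have hD := P.moveZ_nonneg
  have hb : ∀ k, 0 ≤ 2 * P.gap (k + 1) + 2 * P.L ^ 2 * (m * P.moveZ k + P.errY k) :=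
    fun k => by
      have := hY k
      have := hG (k + 1)
      have := hD k
      positivity
  refine (A.wsum_le_of_window P.errS_nonneg hb A.errS_window K).trans ?_
  have h1 := A.wsum_shift_le hG K
  have h2 := A.wsum_le_succ hD K
  have h3 := A.wsum_le_succ hY K
  have h : P.wsum (fun k => 2 * P.gap (k + 1) + 2 * P.L ^ 2 * (m * P.moveZ k + P.errY k)) K
      = 2 * P.wsum (fun k => P.gap (k + 1)) K
        + 2 * P.L ^ 2 * (m * P.wsum P.moveZ K + P.wsum P.errY K) := by
    rw [← wsum_mul P m, ← wsum_add, ← wsum_mul P (2 * P.L ^ 2), ← wsum_mul, ← wsum_add]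
  rw [h]
  have hN := A.one_le_networkCond
  unfold Ms errS
  gcongr

lemma wsum_errY_le (K : ℕ) :
    P.wsum P.errY K ≤ 2 * P.wsum P.errX K + 2 * P.wsum P.errZ K := by
  rw [← wsum_mul, ← wsum_mul, ← wsum_add]
  exact A.wsum_mono A.errY_le K

lemma inv_step_ge : 2122 * P.L ≤ 1 / (2 * P.α) := by
  have hα := A.α_pos
  have hL := A.L_pos
  have h1 := A.α_mul_L_le
  have h2 : P.α * P.L * 1 ≤ P.α * P.L * P.networkCond ^ 3 := by
    have := one_le_pow₀ (n := 3) A.one_le_networkCond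
    gcongr
  rw [le_div_iff₀ (by positivity)]
  linarith

lemma inv_step_sub_nonneg : 0 ≤ 1 / (2 * P.α) - P.L := by
  linarith [A.inv_step_ge, A.L_pos]

/-- The potential inequality, divided by `(1 - θ) ^ (k + 1)` and summed. Since the iterates start in
consensus, the error of `y` at index zero vanishes. -/
lemma potential_sum_le (K : ℕ) : ((1 - P.θ)⁻¹) ^ (K + 1) * P.potential (K + 1)
    ≤ P.potential 0 + ((1 - P.θ)⁻¹) ^ 2 * (P.L / m * P.wsum P.errY K
      - (1 / (2 * P.α) - P.L) * P.wsum P.moveZ K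
      - (1 - P.θ) / (4 * m * P.L) * P.wsum P.gap K) := by
  have hq : 0 < 1 - P.θ := by linarith [A.θ_le]
  have hL := A.L_pos
  have step : ∀ k, ((1 - P.θ)⁻¹) ^ (k + 1) * P.potential (k + 1)
      ≤ ((1 - P.θ)⁻¹) ^ k * P.potential k + ((1 - P.θ)⁻¹) ^ (k + 1) * (P.L / m * P.errY k
        - (1 / (2 * P.α) - P.L) * P.moveZ k - (1 - P.θ) / (4 * m * P.L) * P.gap k) := by
    intro k
    have h := mul_le_mul_of_nonneg_left (A.potential_succ_le k)
      (pow_nonneg (inv_nonneg.2 hq.le) (k + 1))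
    have e : ((1 - P.θ)⁻¹) ^ (k + 1) * ((1 - P.θ) * P.potential k)
        = ((1 - P.θ)⁻¹) ^ k * P.potential k := by
      rw [pow_succ, mul_assoc, inv_mul_cancel_left₀ hq.ne']
    linarith
  induction K with
  | zero =>
    have h := step 0
    have hp := A.one_le_inv
    have hY : P.errY 0 = 0 := by
      have : P.y 0 = P.x₀ := rfl
      simp [errY, this, A.consensus, frobSq]
    have h1 : 0 ≤ (1 / (2 * P.α) - P.L) * P.moveZ 0 :=
      mul_nonneg A.inv_step_sub_nonneg (P.moveZ_nonneg 0)
    have h2 : 0 ≤ (1 - P.θ) / (4 * m * P.L) * P.gap 0 :=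
      mul_nonneg (by positivity) (P.gap_nonneg 0)
    have h3 : (1 - P.θ)⁻¹ ^ (0 + 1) * (P.L / m * P.errY 0
        - (1 / (2 * P.α) - P.L) * P.moveZ 0 - (1 - P.θ) / (4 * m * P.L) * P.gap 0) ≤ 0 := by
      rw [hY]
      exact mul_nonpos_of_nonneg_of_nonpos (by positivity) (by linarith)
    simp only [wsum, Finset.range_zero, Finset.sum_empty]
    rw [pow_zero, one_mul] at h
    linarith
  | succ K ih =>
    have h := step (K + 1)
    have e : ∀ a : ℕ → ℝ, P.wsum a (K + 1) = P.wsum a K + ((1 - P.θ)⁻¹) ^ K * a (K + 1) :=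
      fun a => Finset.sum_range_succ _ _
    rw [e, e, e]
    have e2 : ((1 - P.θ)⁻¹) ^ (K + 1 + 1) = ((1 - P.θ)⁻¹) ^ 2 * ((1 - P.θ)⁻¹) ^ K := by
      rw [← pow_add]; congr 1; omega
    rw [e2] at h ⊢
    linarith

end Admissible
end Setting

/-! ### Closing the loop of the estimates -/

/-- The linear system of estimates between the weighted sums. The errors `y`, `z`, `s` feed back into
themselves only through the factor `η`, which the step size makes small against the powers of the
network condition number `N`. -/
lemma consensus_budget {N η p x y z s d b Mx Mz Ms : ℝ} (hN : 1 ≤ N) (hη0 : 0 ≤ η)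
    (hη : η * N ^ 3 ≤ 1 / 4244) (hp1 : p ≤ 102 / 100) (hp0 : 0 ≤ p)
    (hz0 : 0 ≤ z) (hy0 : 0 ≤ y)
    (hd0 : 0 ≤ d) (hb0 : 0 ≤ b) (hMx : 0 ≤ Mx) (hMz : 0 ≤ Mz) (hMs : 0 ≤ Ms)
    (hx : x ≤ 105 / 100 * (N * Mx + N ^ 2 * z))
    (hz : z ≤ 105 / 100 * (N * Mz + N ^ 2 * (2 * η ^ 2 * (y + s))))
    (hs : s ≤ 105 / 100 * (N * Ms + N ^ 2 * (2 * b + 2 * (d + y))))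
    (hy : y ≤ 2 * x + 2 * z) :
    p * (y + x / 4 - 2121 * d - 1 / 5 * b)
      ≤ 1 / (49 * N) * Ms + 1459 * N ^ 3 * Mz + 66 / 10 * N * Mx := by
  have hN0 : 0 < N := by linarith
  set u := N ^ 2 * z with hu
  have hN2 : 1 ≤ N ^ 2 := one_le_pow₀ hN
  have hzu : z ≤ u := le_mul_of_one_le_left hz0 hN2
  have hκ : η ^ 2 * N ^ 6 ≤ 1 / 10 ^ 7 := by
    have h := pow_le_pow_left₀ (by positivity) hη 2
    calc η ^ 2 * N ^ 6 = (η * N ^ 3) ^ 2 := by ring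
      _ ≤ (1 / 4244) ^ 2 := h
      _ ≤ 1 / 10 ^ 7 := by norm_num
  have hκ4 : η ^ 2 * N ^ 4 ≤ 1 / 10 ^ 7 := by
    refine le_trans ?_ hκ
    gcongr
    norm_num
  have hκ5 : η ^ 2 * N ^ 5 ≤ 1 / 10 ^ 7 * (1 / N) := by
    rw [mul_one_div, le_div_iff₀ hN0]
    linarith
  -- Feed the bound of `s` into the one of `z`.
  have h1 : η ^ 2 * N ^ 4 * s ≤ 105 / 100 * (1 / 10 ^ 7 * (1 / N) * Ms
      + 1 / 10 ^ 7 * (2 * b + 2 * (d + y))) := by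
    have h2 : η ^ 2 * N ^ 4 * s ≤ η ^ 2 * N ^ 4 * (105 / 100 * (N * Ms
        + N ^ 2 * (2 * b + 2 * (d + y)))) := by gcongr
    have h3 : η ^ 2 * N ^ 5 * Ms ≤ 1 / 10 ^ 7 * (1 / N) * Ms := by gcongr
    have h4 : η ^ 2 * N ^ 6 * (2 * b + 2 * (d + y)) ≤ 1 / 10 ^ 7 * (2 * b + 2 * (d + y)) := by
      gcongr
    linarith
  have h5 : η ^ 2 * N ^ 4 * y ≤ 1 / 10 ^ 7 * y := by gcongr
  have h6 : u ≤ 105 / 100 * (N ^ 3 * Mz + 2 * (η ^ 2 * N ^ 4 * y) + 2 * (η ^ 2 * N ^ 4 * s)) := by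
    have := mul_le_mul_of_nonneg_left hz (sq_nonneg N)
    rw [hu]; linarith
  have hMx' : 0 ≤ N * Mx := by positivity
  have hMz' : 0 ≤ N ^ 3 * Mz := by positivity
  have hMs' : 0 ≤ 1 / N * Ms := by positivity
  have e : 1 / (49 * N) * Ms = 1 / 49 * (1 / N * Ms) := by field_simp
  have h7 : y + x / 4 - 2121 * d - 1 / 5 * b
      ≤ 1 / 100 * (1 / N * Ms) + 1000 * (N ^ 3 * Mz) + 5 * (N * Mx) := by linarith
  calc _ ≤ p * (1 / 100 * (1 / N * Ms) + 1000 * (N ^ 3 * Mz) + 5 * (N * Mx)) := by gcongr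
    _ ≤ 102 / 100 * (1 / 100 * (1 / N * Ms) + 1000 * (N ^ 3 * Mz) + 5 * (N * Mx)) := by gcongr
    _ ≤ _ := by rw [e]; linarith

namespace Setting.Admissible

variable {m n : ℕ} {P : Setting m n} (A : P.Admissible)
include A

omit A in
lemma windowMax_nonneg {a : ℕ → ℝ} (ha : ∀ k, 0 ≤ a k) : 0 ≤ P.windowMax a :=
  (ha 1).trans (P.le_windowMax a (k := 0) P.one_le_γ)

/-- The constant `C` with the powers of `1 - σ` and `γ` collected into the network condition number. -/
lemma C_eq : P.C = P.potential 0 + P.L / m * ((1 - P.θ)⁻¹ *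
    (1 / (49 * P.networkCond) * (P.Ms / P.L ^ 2) + 1459 * P.networkCond ^ 3 * P.Mz
      + 66 / 10 * P.networkCond * P.Mx)) := by
  have h1 : 1 - P.σ ≠ 0 := by linarith [A.σ_lt_one]
  have h2 : 1 - P.θ ≠ 0 := by linarith [A.θ_le]
  have h3 := A.L_pos.ne'
  have h4 : (P.γ : ℝ) ≠ 0 := by have := P.one_le_γ; positivity
  have h5 : (m : ℝ) ≠ 0 := by have := A.m_pos; positivity
  unfold C potential networkCond
  rw [← sub_eq_zero]
  norm_num
  field_simp
  ring

/-- The Lyapunov estimate: the potential together with the summed consensus errors of `x` stays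
below the constant `C`. -/
lemma lyapunov_le (K : ℕ) : ((1 - P.θ)⁻¹) ^ (K + 1) * P.potential (K + 1)
    + P.L / (4 * m) * (((1 - P.θ)⁻¹) ^ 2 * P.wsum P.errX K) ≤ P.C := by
  have hL := A.L_pos
  have hα := A.α_pos
  have hm : (0 : ℝ) < m := by exact_mod_cast A.m_pos
  have hN := A.one_le_networkCond
  have hp := A.one_le_inv
  have hθ1 := A.θ_le
  have hp2 : (1 - P.θ)⁻¹ ≤ 102 / 100 := by
    rw [inv_le_iff_one_le_mul₀ (by linarith)]; linarith
  have hMx : 0 ≤ P.Mx := windowMax_nonneg P.errX_nonneg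
  have hMz : 0 ≤ P.Mz := windowMax_nonneg P.errZ_nonneg
  have hMs : 0 ≤ P.Ms := windowMax_nonneg P.errS_nonneg
  have h0 := A.potential_sum_le K
  rw [A.C_eq]
  cases K with
  | zero =>
    have h1 : 0 ≤ P.L / m * ((1 - P.θ)⁻¹ * (1 / (49 * P.networkCond) * (P.Ms / P.L ^ 2)
      + 1459 * P.networkCond ^ 3 * P.Mz + 66 / 10 * P.networkCond * P.Mx)) := by positivity
    simp only [wsum, Finset.range_zero, Finset.sum_empty, mul_zero, sub_zero, add_zero] at h0 ⊢
    linarith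
  | succ K =>
    have hx := A.wsum_errX_le K
    have hz := A.wsum_errZ_le K
    have hs := A.wsum_errS_le K
    have hy := A.wsum_errY_le (K + 1)
    have hz0 := A.wsum_nonneg P.errZ_nonneg (K + 1)
    have hy0 := A.wsum_nonneg P.errY_nonneg (K + 1)
    have hs0 := A.wsum_nonneg P.errS_nonneg (K + 1)
    have hd0 := A.wsum_nonneg P.moveZ_nonneg (K + 1)
    have hb0 := A.wsum_nonneg P.gap_nonneg (K + 1)
    set x := P.wsum P.errX (K + 1)
    set y := P.wsum P.errY (K + 1)
    set z := P.wsum P.errZ (K + 1)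
    set s := P.wsum P.errS (K + 1)
    set d := P.wsum P.moveZ (K + 1)
    set b := P.wsum P.gap (K + 1)
    set N := P.networkCond
    set p := (1 - P.θ)⁻¹
    clear_value x y z s d b
    have hz' : z ≤ 105 / 100 * (N * P.Mz
        + N ^ 2 * (2 * (P.α * P.L) ^ 2 * (y + s / P.L ^ 2))) := by
      refine hz.trans_eq ?_
      field_simp
    have hs' : s / P.L ^ 2 ≤ 105 / 100 * (N * (P.Ms / P.L ^ 2)
        + N ^ 2 * (2 * (b / P.L ^ 2) + 2 * (m * d + y))) := by
      rw [div_le_iff₀ (by positivity)]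
      refine hs.trans_eq ?_
      field_simp
    have budget := consensus_budget (N := N) (η := P.α * P.L) (p := p) (d := m * d)
      (b := b / P.L ^ 2) hN (by positivity) A.α_mul_L_le hp2 (by positivity) hz0 hy0
      (by positivity) (by positivity) hMx hMz (by positivity) hx hz' hs' hy
    have h1 : P.L / m * y - (1 / (2 * P.α) - P.L) * d - (1 - P.θ) / (4 * m * P.L) * b
        + P.L / (4 * m) * x ≤ P.L / m * (y + x / 4 - 2121 * (m * d) - 1 / 5 * (b / P.L ^ 2)) := by
      have e1 : 2121 * P.L * d ≤ (1 / (2 * P.α) - P.L) * d := by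
        have := A.inv_step_ge
        gcongr
        linarith
      have e2 : (4 / 5) / (4 * m * P.L) * b ≤ (1 - P.θ) / (4 * m * P.L) * b := by
        gcongr
        linarith
      have e3 : P.L / m * (y + x / 4 - 2121 * (m * d) - 1 / 5 * (b / P.L ^ 2))
          = P.L / m * y + P.L / (4 * m) * x - 2121 * P.L * d - (4 / 5) / (4 * m * P.L) * b := by
        have c1 : P.L / m * (2121 * (m * d)) = 2121 * P.L * d := by field_simp
        have c2 : P.L / m * (1 / 5 * (b / P.L ^ 2)) = (4 / 5) / (4 * m * P.L) * b := by field_simp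
        rw [mul_sub, mul_sub, c1, c2]
        ring
      linarith
    have h2 := mul_le_mul_of_nonneg_left h1 (sq_nonneg p)
    have h3 := mul_le_mul_of_nonneg_left budget (show 0 ≤ P.L / m * p by positivity)
    have e : p ^ 2 * (P.L / m * (y + x / 4 - 2121 * (m * d) - 1 / 5 * (b / P.L ^ 2)))
        = P.L / m * p * (p * (y + x / 4 - 2121 * (m * d) - 1 / 5 * (b / P.L ^ 2))) := by ring
    rw [e] at h2
    linarith

/-! ### Rates -/

lemma F_sub_nonneg (x : Vec n) : 0 ≤ P.F x - P.F P.xstar := sub_nonneg.2 (A.optimal x)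

lemma F_sub_le_potential (k : ℕ) : P.F (average (P.x k)) - P.F P.xstar ≤ P.potential k := by
  have := A.θ_pos
  have := A.α_pos
  have := A.μ_pos
  unfold potential
  exact le_add_of_nonneg_right (by positivity)

lemma potential_nonneg (k : ℕ) : 0 ≤ P.potential k :=
  (A.F_sub_nonneg _).trans (A.F_sub_le_potential k)

lemma potential_le (K : ℕ) : P.potential (K + 1) ≤ (1 - P.θ) ^ (K + 1) * P.C := by
  have hq : 0 < 1 - P.θ := by linarith [A.θ_le]
  have hL := A.L_pos
  have h := A.lyapunov_le K
  have h1 := A.wsum_nonneg P.errX_nonneg K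
  have h2 : 0 ≤ P.L / (4 * m) * (((1 - P.θ)⁻¹) ^ 2 * P.wsum P.errX K) := by positivity
  rw [← inv_mul_le_iff₀ (by positivity), ← inv_pow]
  linarith

lemma C_nonneg : 0 ≤ P.C := by
  have hq : 0 < 1 - P.θ := by linarith [A.θ_le]
  have h := (A.potential_nonneg 1).trans (A.potential_le 0)
  exact nonneg_of_mul_nonneg_right h (by positivity)

lemma errX_le (K : ℕ) : 1 / (m : ℝ) * P.errX K ≤ (1 - P.θ) ^ (K + 1) * (4 * P.C / P.L) := by
  have hq : 0 < 1 - P.θ := by linarith [A.θ_le]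
  have hL := A.L_pos
  have hm : (0 : ℝ) < m := by exact_mod_cast A.m_pos
  have hC := A.C_nonneg
  cases K with
  | zero =>
    have h0 : P.errX 0 = 0 := by
      have : P.x 0 = P.x₀ := rfl
      simp [errX, this, A.consensus, frobSq]
    rw [h0, mul_zero]
    positivity
  | succ K =>
    have h := A.lyapunov_le (K + 1)
    have h1 := A.potential_nonneg (K + 1 + 1)
    have h2 : 0 ≤ ((1 - P.θ)⁻¹) ^ (K + 1 + 1) * P.potential (K + 1 + 1) := by positivity
    have h3 : ((1 - P.θ)⁻¹) ^ K * P.errX (K + 1) ≤ P.wsum P.errX (K + 1) :=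
      Finset.single_le_sum (f := fun k => ((1 - P.θ)⁻¹) ^ k * P.errX (k + 1))
        (fun k _ => mul_nonneg (by positivity) (P.errX_nonneg _)) (Finset.self_mem_range_succ K)
    have h4 : P.L / (4 * m) * (((1 - P.θ)⁻¹) ^ 2 * (((1 - P.θ)⁻¹) ^ K * P.errX (K + 1)))
        ≤ P.L / (4 * m) * (((1 - P.θ)⁻¹) ^ 2 * P.wsum P.errX (K + 1)) := by gcongr
    have h5 : P.L / (4 * m) * (((1 - P.θ)⁻¹) ^ 2 * (((1 - P.θ)⁻¹) ^ K * P.errX (K + 1)))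
        ≤ P.C := by linarith
    rw [← mul_assoc (_ ^ 2), ← pow_add, add_comm 2 K, inv_pow] at h5
    rw [← inv_mul_le_iff₀ (by positivity)]
    have e : ((1 - P.θ) ^ (K + 2))⁻¹ * (1 / (m : ℝ) * P.errX (K + 1))
        = 4 / P.L * (P.L / (4 * m) * (((1 - P.θ) ^ (K + 2))⁻¹ * P.errX (K + 1))) := by
      field_simp
    rw [show K + 1 + 1 = K + 2 from rfl, e]
    calc _ ≤ 4 / P.L * P.C := by gcongr
      _ = 4 * P.C / P.L := by ring

end Setting.Admissible

/-! ### Complexity -/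

namespace Setting

variable {m n : ℕ} {P : Setting m n}

lemma Assumptions.admissible (A : P.Assumptions) (hα : P.α = P.maxStep) : P.Admissible where
  toAssumptions := A
  α_pos := by
    have := A.L_pos
    have := A.one_le_networkCond
    rw [hα, A.maxStep_eq]; positivity
  α_le := hα.le

lemma rateFactor_nonneg (A : P.Assumptions) : 0 ≤ P.rateFactor := by
  have := A.one_le_networkCond
  exact mul_nonneg (Real.rpow_nonneg (by unfold networkCond at this; linarith) _)
    (Real.sqrt_nonneg _)

lemma rateFactor_sq (A : P.Assumptions) :
    P.rateFactor ^ 2 = P.networkCond ^ 3 * (P.L / P.μ) := by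
  have h1 := A.one_le_networkCond
  have h2 := A.L_pos
  have h3 := A.μ_pos
  rw [rateFactor, mul_pow, Real.sq_sqrt (by positivity), ← networkCond,
    ← Real.rpow_natCast, ← Real.rpow_mul (by linarith), ← Real.rpow_natCast]
  norm_num

lemma networkCond_le_rateFactor (A : P.Assumptions) : P.networkCond ≤ P.rateFactor := by
  have h1 := A.one_le_networkCond
  refine abs_le_of_sq_le_sq' ?_ (rateFactor_nonneg A) |>.2
  rw [rateFactor_sq A]
  have h2 : 1 ≤ P.L / P.μ := (one_le_div A.μ_pos).2 A.μ_le_L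
  calc P.networkCond ^ 2 ≤ P.networkCond ^ 3 * 1 := by
        rw [mul_one]; exact pow_le_pow_right₀ h1 (by norm_num)
    _ ≤ _ := by gcongr

/-- With the largest step size, the rate `θ` is a constant multiple of the inverse of the rate
factor, namely `1 / (2 * √4244)`. -/
lemma one_le_θ_mul_rateFactor (A : P.Assumptions) (hα : P.α = P.maxStep) :
    1 ≤ 131 * (P.θ * P.rateFactor) := by
  have B := A.admissible hα
  have h1 := A.one_le_networkCond
  have h2 := A.L_pos
  have h3 := A.μ_pos
  have h4 : (P.θ * P.rateFactor) ^ 2 = 1 / 16976 := by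
    rw [mul_pow, B.θ_sq, rateFactor_sq A, hα, A.maxStep_eq]
    field_simp
    norm_num
  have h5 : (1 / 131 : ℝ) ≤ P.θ * P.rateFactor :=
    abs_le_of_sq_le_sq' (by rw [h4]; norm_num)
      (mul_nonneg B.θ_pos.le (rateFactor_nonneg A)) |>.2
  linarith

/-- After the stated number of iterations the rate has brought `C` below the target accuracy. This
includes `C = 0`, where the logarithm is a junk value. -/
lemma pow_mul_C_le (A : P.Assumptions) (hα : P.α = P.maxStep) {c ε : ℝ} (hc : 131 ≤ c)
    (hε : 0 < ε) {K : ℕ} (hK : c * P.rateFactor * Real.log (P.C / ε) ≤ K) :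
    (1 - P.θ) ^ K * P.C ≤ ε := by
  have B := A.admissible hα
  have hθ := B.θ_pos
  have hq : 0 ≤ 1 - P.θ := by linarith [B.θ_le]
  rcases B.C_nonneg.eq_or_lt with h0 | hC
  · rw [← h0, mul_zero]; exact hε.le
  have hlog : Real.log (P.C / ε) ≤ P.θ * K := by
    rcases le_total (Real.log (P.C / ε)) 0 with h | h
    · exact h.trans (by positivity)
    · have h1 := mul_le_mul_of_nonneg_left hK hθ.le
      have h2 := one_le_θ_mul_rateFactor A hα
      have h3 : 1 ≤ c * (P.θ * P.rateFactor) := by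
        refine h2.trans ?_
        have := rateFactor_nonneg A
        gcongr
      have h4 := mul_le_mul_of_nonneg_right h3 h
      linarith
  have h1 : (1 - P.θ) ^ K ≤ Real.exp (-(P.θ * K)) := by
    calc (1 - P.θ) ^ K ≤ Real.exp (-P.θ) ^ K := by
          gcongr
          linarith [Real.add_one_le_exp (-P.θ)]
      _ = Real.exp (-(P.θ * K)) := by rw [← Real.exp_nat_mul]; ring_nf
  have h2 : Real.exp (-(P.θ * K)) ≤ ε / P.C := by
    rw [← Real.exp_log (show 0 < ε / P.C by positivity), Real.exp_le_exp, ← inv_div,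
      Real.log_inv]
    linarith
  calc (1 - P.θ) ^ K * P.C ≤ ε / P.C * P.C := by gcongr; exact h1.trans h2
    _ = ε := by field_simp

lemma accuracy (A : P.Assumptions) (hα : P.α = P.maxStep) {c ε : ℝ} (hc : 131 ≤ c)
    (hε : 0 < ε) {K : ℕ} (hK : c * P.rateFactor * Real.log (P.C / ε) ≤ (K + 1 : ℕ)) :
    P.F (average (P.x (K + 1))) - P.F P.xstar ≤ ε ∧ 1 / (m : ℝ) * P.errX K ≤ 4 * ε / P.L := by
  have B := A.admissible hα
  have hL := A.L_pos
  have h := pow_mul_C_le A hα hc hε hK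
  refine ⟨(B.F_sub_le_potential _).trans ((B.potential_le K).trans h),
    (B.errX_le K).trans ?_⟩
  rw [← mul_div_assoc, mul_left_comm]
  gcongr

/-- For accuracies below `1 / C` and `1 / 2`, the number of windows can be chosen so that the
iteration count is of the order of the rate factor times `log (1 / ε)`. -/
lemma exists_iterations (A : P.Assumptions) (hα : P.α = P.maxStep) {ε : ℝ} (hε : 0 < ε)
    (hε2 : ε ≤ 1 / 2) (hCε : P.C * ε ≤ 1) :
    ∃ T : ℕ, 131 * P.rateFactor * Real.log (P.C / ε) ≤ (T * P.γ + 1 : ℕ) ∧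
      ((T * P.γ + 1 : ℕ) : ℝ) + 1 ≤ 270 * P.rateFactor * Real.log (1 / ε) := by
  have B := A.admissible hα
  have hC0 := B.C_nonneg
  set ℓ := Real.log (1 / ε) with hℓ
  have hℓ2 : 69 / 100 ≤ ℓ := by
    have h1 : Real.log 2 ≤ ℓ :=
      Real.log_le_log (by norm_num) (by rw [le_div_iff₀ hε]; linarith)
    linarith [Real.log_two_gt_d9]
  have hlog : Real.log (P.C / ε) ≤ 2 * ℓ := by
    rcases hC0.eq_or_lt with h0 | hC
    · rw [← h0, zero_div, Real.log_zero]; linarith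
    · rw [two_mul, hℓ, ← Real.log_mul (by positivity) (by positivity)]
      refine Real.log_le_log (by positivity) ?_
      rw [div_eq_mul_one_div]
      gcongr
      rwa [le_div_iff₀ hε]
  have hR0 := rateFactor_nonneg A
  have hRγ : (P.γ : ℝ) ≤ P.rateFactor := A.γ_le_networkCond.trans (networkCond_le_rateFactor A)
  have hR1 : 1 ≤ P.rateFactor := A.one_le_networkCond.trans (networkCond_le_rateFactor A)
  have hγ : (0 : ℝ) < P.γ := by exact_mod_cast P.one_le_γ
  -- `262 = 2 * 131`; the excess of `270` absorbs the rounding up to a multiple of `γ` and the two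
  -- units, each at most `R ≤ R * ℓ / 0.69`.
  set X := 262 * P.rateFactor * ℓ with hX
  have hX0 : 0 ≤ X := by positivity
  refine ⟨⌈X / P.γ⌉₊, ?_, ?_⟩
  · have h1 := Nat.le_ceil (X / P.γ)
    rw [div_le_iff₀ hγ] at h1
    have h2 : 131 * P.rateFactor * Real.log (P.C / ε) ≤ 131 * P.rateFactor * (2 * ℓ) := by
      gcongr
    push_cast
    linarith
  · have h1 := (Nat.ceil_lt_add_one (show 0 ≤ X / P.γ by positivity)).le
    have h2 := mul_le_mul_of_nonneg_right h1 hγ.le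
    rw [add_mul, div_mul_cancel₀ _ hγ.ne'] at h2
    have h3 := mul_le_mul_of_nonneg_left hℓ2 hR0
    push_cast
    linarith

end Setting

end AccGT

end

theorem theorem4 :
    (∀ (m n : ℕ) (P : AccGT.Setting m n), P.Assumptions → 0 < P.α → P.α ≤ P.maxStep →
      ∀ T : ℕ,
        P.F (AccGT.average (P.x (T * P.γ + 1))) - P.F P.xstar
            + (P.θ ^ 2 / (2 * P.α) + P.μ * P.θ / 2)
              * ‖AccGT.average (P.z (T * P.γ + 1)) - P.xstar‖ ^ 2
          ≤ (1 - P.θ) ^ (T * P.γ + 1) * P.C ∧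
        (1 / (m : ℝ)) * AccGT.frobSq (AccGT.consensusError (P.x (T * P.γ)))
          ≤ (1 - P.θ) ^ (T * P.γ + 1) * (4 * P.C / P.L)) ∧
    (∃ c : ℝ, 0 < c ∧
      ∀ (m n : ℕ) (P : AccGT.Setting m n), P.Assumptions → P.α = P.maxStep →
        ∀ ε : ℝ, 0 < ε →
          (∀ T : ℕ, c * P.rateFactor * Real.log (P.C / ε) ≤ (T * P.γ + 1 : ℕ) →
            P.F (AccGT.average (P.x (T * P.γ + 1))) - P.F P.xstar ≤ ε ∧
            (1 / (m : ℝ)) * AccGT.frobSq (AccGT.consensusError (P.x (T * P.γ)))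
              ≤ 4 * ε / P.L) ∧
          (ε ≤ 1 / 2 → P.C * ε ≤ 1 →
            ∃ T : ℕ,
              P.F (AccGT.average (P.x (T * P.γ + 1))) - P.F P.xstar ≤ ε ∧
              ((P.run (T * P.γ + 1)).grads : ℝ) ≤ c * P.rateFactor * Real.log (1 / ε) ∧
              ((P.run (T * P.γ + 1)).comms : ℝ) ≤ c * P.rateFactor * Real.log (1 / ε))) := by
  refine ⟨fun m n P A hα0 hα T => ?_, 1000, by norm_num, fun m n P A hα ε hε => ⟨?_, ?_⟩⟩
  · have B : P.Admissible := ⟨A, hα0, hα⟩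
    exact ⟨B.potential_le _, B.errX_le _⟩
  · intro T hT
    exact AccGT.Setting.accuracy A hα (by norm_num) hε hT
  · intro hε2 hCε
    obtain ⟨T, hT1, hT2⟩ := AccGT.Setting.exists_iterations A hα hε hε2 hCε
    refine ⟨T, (AccGT.Setting.accuracy A hα le_rfl hε hT1).1, ?_, ?_⟩
    · have h0 : (0 : ℝ) ≤ ((T * P.γ + 1 : ℕ) : ℝ) := Nat.cast_nonneg _
      rw [AccGT.Setting.grads_run]
      push_cast at *
      linarith
    · have h0 : (0 : ℝ) ≤ ((T * P.γ + 1 : ℕ) : ℝ) := Nat.cast_nonneg _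
      rw [AccGT.Setting.comms_run]
      push_cast at *
      linarith
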